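/- Let $\Omega\subset\mathbb R^d$ be a connected (non-empty), open and bounded set with $C^{1,1}$ boundary, and let $\mu$ be a probability measure on $\Omega$ with smooth Lebesgue density $\rho$ satisfying $\rho^-\le\rho\le\rho^+$ on $\Omega$ for some constants $0<\rho^-\le\rho^+<\infty$. Let $\mathcal L u=-\frac1\rho\nabla\cdot(\rho^2\nabla u)$ with Neumann boundary condition $\partial u/\partial n=0$ on $\partial\Omega$, understood in the weak sense: $\mathcal L u=f\in L^2_\mu$ means that $u\in H^1(\Omega)$ and $\int_\Omega\rho^2\nabla u\cdot\nabla v\,dx=\int_\Omega f v\rho\,dx$ for all $v\in H^1(\Omega)$. Let $\Omega^+,\Omega^-\subset\Omega$ be measurable sets of positive Lebesgue measure with $\overline{\Omega^+}\cap\overline{\Omega^-}=\emptyset$ and $\operatorname{dist}(\Omega^+,\Omega^-)>0$, put $\Omega'=\Omega^+\cup\Omega^-$, and let $y=1$ on $\Omega^+$ and $y=-1$ on $\Omega^-$ (Labelling Model 1). Let $\alpha\ge1$, $\tau\ge0$ and $\gamma>0$. Then $L^2_\mu$ has an orthonormal basis $(\varphi_k)_{k\ge1}$ of eigenfunctions of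 $\mathcal L$, with eigenvalues $\lambda_1\le\lambda_2\le\cdots$ listed in non-decreasing order. For every such choice of $(\lambda_k,\varphi_k)_{k\ge1}$, the functional $$\mathsf J_{\rm p}(v)=\frac12\sum_{k=1}^\infty(\lambda_k+\tau^2)^\alpha\langle v,\varphi_k\rangle_\mu^2-\int_{\Omega'}\log\Psi(y(x)v(x);\gamma)\,d\mu(x),\qquad \Psi(s;\gamma)=\frac1{\sqrt{2\pi\gamma^2}}\int_{-\infty}^s e^{-t^2/2\gamma^2}\,dt,$$ where the first term is $\frac12\langle v,(\mathcal L+\tau^2I)^\alpha v\rangle_\mu$, has a unique minimizer in $$\mathcal H^\alpha(\Omega)=\Big\{u\in L^2_\mu:\ \sum_{k=1}^\infty\lambda_k^\alpha\langle u,\varphi_k\rangle_\mu^2<\infty\Big\}.$$ -/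

import Mathlib

open MeasureTheory
open scoped ENNReal NNReal Topology ContDiff

noncomputable section

namespace ProbitLimit

/-- Euclidean space `ℝ^d`. -/
abbrev Euc (d : ℕ) : Type := EuclideanSpace ℝ (Fin d)

/-- `Ω` has `C^{1,1}` boundary: near each boundary point there are a unit vector `e` and a
differentiable function `g` of the variables orthogonal to `e`, with Lipschitz derivative, such
that `Ω` is locally the region strictly above the graph of `g` in the direction `e`. -/
def HasC11Boundary {d : ℕ} (Ω : Set (Euc d)) : Prop :=
  ∀ x₀ ∈ frontier Ω, ∃ U ∈ 𝓝 x₀, ∃ e : Euc d, ‖e‖ = 1 ∧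
    ∃ g : (Submodule.span ℝ {e})ᗮ → ℝ, Differentiable ℝ g ∧
      (∃ K : ℝ≥0, LipschitzWith K (fderiv ℝ g)) ∧
      ∀ x ∈ U, x ∈ Ω ↔ g ((Submodule.span ℝ {e})ᗮ.orthogonalProjectionOnto x) < inner ℝ e x

/-- A connected (in particular non-empty), open, bounded set with `C^{1,1}` boundary. -/
structure IsC11Domain {d : ℕ} (Ω : Set (Euc d)) : Prop where
  isConnected : IsConnected Ω
  isOpen : IsOpen Ω
  isBounded : Bornology.IsBounded Ω
  boundary : HasC11Boundary Ω

/-- The measure `μ` on `Ω` with Lebesgue density `ρ`. -/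
def dataMeasure {d : ℕ} (Ω : Set (Euc d)) (ρ : Euc d → ℝ) : Measure (Euc d) :=
  (volume.restrict Ω).withDensity fun x => ENNReal.ofReal (ρ x)

/-- `ρ` is a smooth probability density on `Ω`, bounded above and below by positive constants. -/
structure IsSmoothDensity {d : ℕ} (Ω : Set (Euc d)) (ρ : Euc d → ℝ) : Prop where
  smooth : ContDiffOn ℝ ∞ ρ Ω
  bounds : ∃ ρmin ρmax : ℝ, 0 < ρmin ∧ ∀ x ∈ Ω, ρmin ≤ ρ x ∧ ρ x ≤ ρmax
  isProbability : IsProbabilityMeasure (dataMeasure Ω ρ)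

/-- The space `L²_μ(Ω; ℝ)`. -/
abbrev L2 {d : ℕ} (Ω : Set (Euc d)) (ρ : Euc d → ℝ) : Type :=
  Lp ℝ 2 (dataMeasure Ω ρ)

/-- `u ∈ H¹(Ω)` with weak gradient `G`: both are square integrable on `Ω`, and
`∫_Ω u ∇φ = - ∫_Ω φ G` for all smooth `φ` compactly supported in `Ω`. -/
structure IsH1 {d : ℕ} (Ω : Set (Euc d)) (u : Euc d → ℝ) (G : Euc d → Euc d) : Prop where
  memLp : MemLp u 2 (volume.restrict Ω)
  memLp_grad : MemLp G 2 (volume.restrict Ω)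
  weak_grad : ∀ φ : Euc d → ℝ, ContDiff ℝ ∞ φ → HasCompactSupport φ → tsupport φ ⊆ Ω →
    ∫ x in Ω, u x • gradient φ x = - ∫ x in Ω, φ x • G x

/-- `u` lies in the domain of the operator `𝓛 u = - ρ⁻¹ ∇ · (ρ² ∇ u)` with homogeneous Neumann
condition `∂u/∂n = 0` on `∂Ω`, and `𝓛 u = f`, in the weak sense: `u ∈ H¹(Ω)` and
`∫_Ω ρ² ∇u · ∇v dx = ∫_Ω f v ρ dx` for all `v ∈ H¹(Ω)`. The boundary condition is encoded by
testing against all of `H¹(Ω)`. -/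
def IsNeumannImage {d : ℕ} (Ω : Set (Euc d)) (ρ : Euc d → ℝ) (u f : L2 Ω ρ) : Prop :=
  ∃ G : Euc d → Euc d, IsH1 Ω u G ∧
    ∀ (v : Euc d → ℝ) (H : Euc d → Euc d), IsH1 Ω v H →
      ∫ x in Ω, ρ x ^ 2 * inner ℝ (G x) (H x) = ∫ x in Ω, f x * v x * ρ x

/-- The orthonormal basis `φ` of `L²_μ` consists of eigenfunctions of `𝓛`, with eigenvalues `lam`
listed in non-decreasing order (indices start from `0`). -/
structure IsEigensystem {d : ℕ} (Ω : Set (Euc d)) (ρ : Euc d → ℝ)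
    (lam : ℕ → ℝ) (φ : HilbertBasis ℕ ℝ (L2 Ω ρ)) : Prop where
  monotone : Monotone lam
  eigen : ∀ k, IsNeumannImage Ω ρ (φ k) (lam k • φ k)

/-- The spectral Sobolev space `𝓗^s(Ω) = {u ∈ L²_μ : ∑ λ_k^s ⟨u, φ_k⟩_μ² < ∞}`. -/
def spectralSobolev {d : ℕ} {Ω : Set (Euc d)} {ρ : Euc d → ℝ}
    (lam : ℕ → ℝ) (φ : HilbertBasis ℕ ℝ (L2 Ω ρ)) (s : ℝ) : Set (L2 Ω ρ) :=
  {u | Summable fun k => lam k ^ s * (inner ℝ u (φ k)) ^ 2}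

/-- The limiting quadratic form
`J_∞(u) = ½ ⟨u, (𝓛 + τ²)^α u⟩_μ = ½ ∑ (λ_k + τ²)^α ⟨u, φ_k⟩_μ²`, with values in `[0, ∞]`. -/
def quadraticForm {d : ℕ} {Ω : Set (Euc d)} {ρ : Euc d → ℝ}
    (lam : ℕ → ℝ) (φ : HilbertBasis ℕ ℝ (L2 Ω ρ)) (α τ : ℝ) (u : L2 Ω ρ) : ℝ≥0∞ :=
  2⁻¹ * ∑' k, ENNReal.ofReal ((lam k + τ ^ 2) ^ α * (inner ℝ u (φ k)) ^ 2)

/-- `Ψ(v; γ) = (2πγ²)^{-1/2} ∫_{-∞}^v exp(-t²/(2γ²)) dt`. -/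
def Psi (v γ : ℝ) : ℝ :=
  1 / Real.sqrt (2 * Real.pi * γ ^ 2) * ∫ t in Set.Iic v, Real.exp (-t ^ 2 / (2 * γ ^ 2))

/-- The labelled sets `Ω⁺`, `Ω⁻` and the labels `y`: the sets are measurable subsets of `Ω` of
positive Lebesgue measure, have disjoint closures and are at positive distance from each other;
`y = 1` on `Ω⁺` and `y = -1` on `Ω⁻`. -/
structure IsLabelling {d : ℕ} (Ω Ωpos Ωneg : Set (Euc d)) (y : Euc d → ℝ) : Prop where
  subset_pos : Ωpos ⊆ Ω
  subset_neg : Ωneg ⊆ Ω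
  measurable_pos : MeasurableSet Ωpos
  measurable_neg : MeasurableSet Ωneg
  volume_pos : 0 < volume Ωpos
  volume_neg : 0 < volume Ωneg
  disjoint : Disjoint (closure Ωpos) (closure Ωneg)
  separated : Metric.AreSeparated Ωpos Ωneg
  label_pos : ∀ x ∈ Ωpos, y x = 1
  label_neg : ∀ x ∈ Ωneg, y x = -1

/-- The label term `Φ(v; γ) = - ∫_{Ω'} log Ψ(y(x) v(x); γ) dμ(x)`. Since `0 < Ψ < 1`, the
integrand `- log Ψ` is positive, and its integral is taken with values in `[0, ∞]`. -/
def labelTerm {d : ℕ} {Ω : Set (Euc d)} {ρ : Euc d → ℝ}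
    (Ω' : Set (Euc d)) (y : Euc d → ℝ) (γ : ℝ) (v : L2 Ω ρ) : ℝ≥0∞ :=
  ∫⁻ x in Ω', ENNReal.ofReal (-Real.log (Psi (y x * v x) γ)) ∂(dataMeasure Ω ρ)

/-- The continuum probit functional `J_p = J_∞ + Φ`. -/
def probit {d : ℕ} {Ω : Set (Euc d)} {ρ : Euc d → ℝ}
    (lam : ℕ → ℝ) (φ : HilbertBasis ℕ ℝ (L2 Ω ρ)) (α τ : ℝ)
    (Ω' : Set (Euc d)) (y : Euc d → ℝ) (γ : ℝ) (v : L2 Ω ρ) : ℝ≥0∞ :=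
  quadraticForm lam φ α τ v + labelTerm Ω' y γ v

end ProbitLimit

end

/-! Spectral part. Give H¹(Ω) the inner product ∫ u v ρ + ∫ ρ² ∇u · ∇v and let J be its embedding
into L²_μ. J is compact by a Rellich argument (`IsC11Domain.tendsto_lintegral_sq`) and has dense
range, so J J* is compact, symmetric and positive definite, and has an orthonormal eigenbasis with
eigenvalues m_k > 0. Read against H¹, its eigenvalue equation is the weak Neumann problem with λ_k =
1/m_k - 1. Conversely, in every eigensystem λ_k ≥ 0, λ_k → ∞ because J is compact, and only λ_0 can
vanish, because a function with zero gradient on a connected open set is constant.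

Existence is the direct method in L²_μ. Both terms are lower semicontinuous. The quadratic form Q
bounds all modes k ≥ 1. If λ_0 = τ = 0 it does not see constants, and the label term takes over:
-log Ψ lies above a line of negative slope, so a large positive constant is expensive on Ω⁻ and a
large negative one on Ω⁺ (`IsEigensystem.exists_norm_le`). Since the weights (λ_k + τ²)^α tend to
infinity, the sublevel sets are then compact.

Uniqueness. For two minimizers v, w, the parallelogram law for Q and the convexity of the label term
force Q((v - w)/2) = 0. Hence v = w, unless λ_0 = τ = 0 and v - w is a nonzero constant. The latter
is excluded by the strict convexity of -log Ψ, which comes down to an inequality for Mills' ratio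
(`mills_bound`), because Ω' has positive measure.

The functional is infinite outside 𝓗^α(Ω), so minimizers there are the minimizers over all of L²_μ.
-/

namespace ProbitLimit

/-! ### The Gaussian distribution function and its strict log-concavity. -/

section GaussianCdf

variable {γ : ℝ}

theorem integrable_gaussianKernel (hγ : 0 < γ) :
    Integrable fun t : ℝ => Real.exp (-t ^ 2 / (2 * γ ^ 2)) := by
  have h := integrable_exp_neg_mul_sq (b := 1 / (2 * γ ^ 2)) (by positivity)
  refine h.congr (Filter.Eventually.of_forall fun t => ?_)
  simp only
  congr 1
  ring

theorem integral_gaussianKernel (hγ : 0 < γ) :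
    ∫ t : ℝ, Real.exp (-t ^ 2 / (2 * γ ^ 2)) = Real.sqrt (2 * Real.pi * γ ^ 2) := by
  have h := integral_gaussian (1 / (2 * γ ^ 2))
  have e : Real.pi / (1 / (2 * γ ^ 2)) = 2 * Real.pi * γ ^ 2 := by field_simp
  rw [e] at h
  rw [← h]
  congr 1
  ext t
  congr 1
  ring

theorem setIntegral_gaussianKernel_pos (hγ : 0 < γ) {s : Set ℝ} (hs : volume s ≠ 0) :
    0 < ∫ t in s, Real.exp (-t ^ 2 / (2 * γ ^ 2)) := by
  rw [setIntegral_pos_iff_support_of_nonneg_ae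
    (Filter.Eventually.of_forall fun t => (Real.exp_pos _).le)
    (integrable_gaussianKernel hγ).integrableOn]
  have : (Function.support fun t : ℝ => Real.exp (-t ^ 2 / (2 * γ ^ 2))) = Set.univ := by
    ext t; simp [Real.exp_ne_zero]
  rw [this, Set.univ_inter]
  exact pos_iff_ne_zero.2 hs

theorem Psi_pos (hγ : 0 < γ) (s : ℝ) : 0 < Psi s γ := by
  unfold Psi
  have := setIntegral_gaussianKernel_pos hγ (s := Set.Iic s) (by simp)
  positivity

theorem Psi_lt_one (hγ : 0 < γ) (s : ℝ) : Psi s γ < 1 := by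
  have h1 := setIntegral_gaussianKernel_pos hγ (s := Set.Ioi s) (by simp)
  have h2 := intervalIntegral.integral_Iic_add_Ioi
    (integrable_gaussianKernel hγ).integrableOn (integrable_gaussianKernel hγ).integrableOn (b := s)
  rw [integral_gaussianKernel hγ] at h2
  unfold Psi
  have h3 : 0 < Real.sqrt (2 * Real.pi * γ ^ 2) := by
    have := Real.pi_pos
    positivity
  rw [one_div_mul_eq_div, div_lt_one h3]
  linarith

theorem neg_log_Psi_pos (hγ : 0 < γ) (s : ℝ) : 0 < -Real.log (Psi s γ) :=
  neg_pos.2 (Real.log_neg (Psi_pos hγ s) (Psi_lt_one hγ s))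

theorem hasDerivAt_integral_gaussianKernel (hγ : 0 < γ) (s : ℝ) :
    HasDerivAt (fun v => ∫ t in Set.Iic v, Real.exp (-t ^ 2 / (2 * γ ^ 2)))
      (Real.exp (-s ^ 2 / (2 * γ ^ 2))) s := by
  have hi := integrable_gaussianKernel hγ
  have hc : Continuous fun t : ℝ => Real.exp (-t ^ 2 / (2 * γ ^ 2)) := by fun_prop
  have h := (intervalIntegral.integral_hasDerivAt_right (hc.intervalIntegrable 0 s)
    (hc.stronglyMeasurableAtFilter _ _) hc.continuousAt).const_add
    (∫ t in Set.Iic (0 : ℝ), Real.exp (-t ^ 2 / (2 * γ ^ 2)))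
  refine h.congr_of_eventuallyEq (Filter.Eventually.of_forall fun v => ?_)
  simp only
  rw [← intervalIntegral.integral_Iic_sub_Iic hi.integrableOn hi.integrableOn]
  ring

theorem hasDerivAt_gaussianKernel (γ s : ℝ) :
    HasDerivAt (fun t : ℝ => Real.exp (-t ^ 2 / (2 * γ ^ 2)))
      (-s / γ ^ 2 * Real.exp (-s ^ 2 / (2 * γ ^ 2))) s := by
  have h := (((hasDerivAt_pow 2 s).neg).div_const (2 * γ ^ 2)).exp
  refine h.congr_deriv ?_
  simp only [Nat.cast_ofNat, Nat.add_one_sub_one, pow_one, Pi.neg_apply]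
  rw [mul_comm]
  congr 1
  by_cases h0 : γ = 0
  · simp [h0]
  · field_simp

/-- The kernel at s is the integral over (-∞, s] of its own derivative, in which the factor is
-t/γ²; this exceeds -s/γ² for t < s. -/
theorem mills_bound (hγ : 0 < γ) (s : ℝ) :
    -s / γ ^ 2 * ∫ t in Set.Iic s, Real.exp (-t ^ 2 / (2 * γ ^ 2)) <
      Real.exp (-s ^ 2 / (2 * γ ^ 2)) := by
  have hi := integrable_gaussianKernel hγ
  have hi' : Integrable fun t : ℝ => -t / γ ^ 2 * Real.exp (-t ^ 2 / (2 * γ ^ 2)) := by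
    have h := (integrable_mul_exp_neg_mul_sq (b := 1 / (2 * γ ^ 2)) (by positivity)).const_mul
      (-(1 / γ ^ 2))
    refine h.congr (Filter.Eventually.of_forall fun t => ?_)
    simp only
    have : -(1 / (2 * γ ^ 2)) * t ^ 2 = -t ^ 2 / (2 * γ ^ 2) := by ring
    rw [this]
    ring
  have hlim : Filter.Tendsto (fun t : ℝ => Real.exp (-t ^ 2 / (2 * γ ^ 2))) Filter.atBot (𝓝 0) := by
    refine Real.tendsto_exp_atBot.comp ?_
    have h1 : Filter.Tendsto (fun t : ℝ => t ^ 2) Filter.atBot Filter.atTop := by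
      have := (Filter.tendsto_pow_atTop (α := ℝ) two_ne_zero).comp Filter.tendsto_neg_atBot_atTop
      refine this.congr fun t => ?_
      simp
    have h2 := Filter.tendsto_neg_atTop_atBot.comp h1
    exact h2.atBot_div_const (by positivity)
  have hval := integral_Iic_of_hasDerivAt_of_tendsto (a := s)
    (hasDerivAt_gaussianKernel γ s).continuousAt.continuousWithinAt
    (fun t _ => hasDerivAt_gaussianKernel γ t) hi'.integrableOn hlim
  rw [sub_zero] at hval
  rw [← hval, ← integral_const_mul, ← sub_pos, ← integral_sub hi'.integrableOn
    (hi.const_mul _).integrableOn]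
  rw [setIntegral_pos_iff_support_of_nonneg_ae]
  · refine lt_of_lt_of_le (b := volume (Set.Iio s)) (by simp) (measure_mono fun t ht =>
      ⟨?_, Set.Iio_subset_Iic_self ht⟩)
    · rw [Function.mem_support, ← sub_mul]
      refine mul_ne_zero ?_ (Real.exp_ne_zero _)
      rw [← sub_div]
      have : t < s := ht
      exact div_ne_zero (by linarith) (by positivity)
  · filter_upwards [ae_restrict_mem measurableSet_Iic] with t ht
    have : t ≤ s := ht
    simp only [Pi.zero_apply]
    rw [← sub_mul, ← sub_div]
    have h3 : 0 ≤ -t - -s := by linarith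
    positivity
  · exact (hi'.sub (hi.const_mul _)).integrableOn

/-- The derivative of `log Ψ`. -/
noncomputable def hazard (γ s : ℝ) : ℝ :=
  Real.exp (-s ^ 2 / (2 * γ ^ 2)) / ∫ t in Set.Iic s, Real.exp (-t ^ 2 / (2 * γ ^ 2))

theorem hazard_pos (hγ : 0 < γ) (s : ℝ) : 0 < hazard γ s :=
  div_pos (Real.exp_pos _) (setIntegral_gaussianKernel_pos hγ (by simp))

theorem hasDerivAt_log_Psi (hγ : 0 < γ) (s : ℝ) :
    HasDerivAt (fun v => Real.log (Psi v γ)) (hazard γ s) s := by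
  have hI := setIntegral_gaussianKernel_pos hγ (s := Set.Iic s) (by simp)
  have h := ((hasDerivAt_integral_gaussianKernel hγ s).const_mul
    (1 / Real.sqrt (2 * Real.pi * γ ^ 2))).log (Psi_pos hγ s).ne'
  refine h.congr_deriv ?_
  have h3 : 0 < Real.sqrt (2 * Real.pi * γ ^ 2) := by
    have := Real.pi_pos
    positivity
  unfold hazard
  field_simp

/-- By the quotient rule the sign of the derivative is that of the difference of the two sides of
`mills_bound`. This is the strict concavity of log Ψ. -/
theorem strictAnti_hazard (hγ : 0 < γ) : StrictAnti (hazard γ) := by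
  refine strictAnti_of_deriv_neg fun s => ?_
  have hI := setIntegral_gaussianKernel_pos hγ (s := Set.Iic s) (by simp)
  have h := (hasDerivAt_gaussianKernel γ s).div (hasDerivAt_integral_gaussianKernel hγ s) hI.ne'
  have h' : deriv (hazard γ) s = _ := h.deriv
  rw [h']
  refine div_neg_of_neg_of_pos ?_ (by positivity)
  have := mul_lt_mul_of_pos_right (mills_bound hγ s) (Real.exp_pos (-s ^ 2 / (2 * γ ^ 2)))
  linarith

theorem strictConcaveOn_log_Psi (hγ : 0 < γ) :
    StrictConcaveOn ℝ Set.univ fun s => Real.log (Psi s γ) := by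
  refine StrictAntiOn.strictConcaveOn_of_deriv convex_univ
    (fun s _ => (hasDerivAt_log_Psi hγ s).continuousAt.continuousWithinAt) ?_
  have : deriv (fun s => Real.log (Psi s γ)) = hazard γ :=
    funext fun s => (hasDerivAt_log_Psi hγ s).deriv
  rw [this]
  exact (strictAnti_hazard hγ).strictAntiOn _

theorem continuous_log_Psi (hγ : 0 < γ) : Continuous fun s => Real.log (Psi s γ) :=
  continuous_iff_continuousAt.2 fun s => (hasDerivAt_log_Psi hγ s).continuousAt

theorem neg_log_Psi_midpoint_lt (hγ : 0 < γ) {s t : ℝ} (h : s ≠ t) :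
    -Real.log (Psi ((s + t) / 2) γ) < (-Real.log (Psi s γ) + -Real.log (Psi t γ)) / 2 := by
  have hhalf : (0 : ℝ) < 1 / 2 := by norm_num
  have := (strictConcaveOn_log_Psi hγ).2 (Set.mem_univ s) (Set.mem_univ t) h hhalf hhalf
    (by norm_num)
  simp only [smul_eq_mul] at this
  rw [show 1 / 2 * s + 1 / 2 * t = (s + t) / 2 by ring] at this
  linarith

theorem neg_log_Psi_midpoint_le (hγ : 0 < γ) (s t : ℝ) :
    -Real.log (Psi ((s + t) / 2) γ) ≤ (-Real.log (Psi s γ) + -Real.log (Psi t γ)) / 2 := by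
  by_cases h : s = t
  · subst h
    simp
  · exact (neg_log_Psi_midpoint_lt hγ h).le

/-- `-log Ψ` lies above its tangent line at the origin. -/
theorem neg_mul_le_neg_log_Psi (hγ : 0 < γ) (s : ℝ) :
    -(hazard γ 0 * s) ≤ -Real.log (Psi s γ) := by
  -- The tangent line has the positive constant term -log Ψ(0), which is dropped from the bound.
  have h0 := neg_log_Psi_pos hγ 0
  have hd := hasDerivAt_log_Psi hγ 0
  have hc := (strictConcaveOn_log_Psi hγ).concaveOn
  rcases lt_trichotomy s 0 with hs | hs | hs
  · have := hc.le_slope_of_hasDerivAt (Set.mem_univ s) (Set.mem_univ 0) hs hd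
    rw [slope_def_field, le_div_iff₀ (by linarith)] at this
    linarith
  · subst hs
    linarith
  · have := hc.slope_le_of_hasDerivAt (Set.mem_univ 0) (Set.mem_univ s) hs hd
    rw [slope_def_field, div_le_iff₀ (by linarith)] at this
    linarith

end GaussianCdf

/-! ### Compact operators, eigenbases and compact ellipsoids in Hilbert space. -/

section HilbertSpace

open Filter

variable {V H : Type*} [NormedAddCommGroup V] [InnerProductSpace ℝ V] [CompleteSpace V]
  [NormedAddCommGroup H] [InnerProductSpace ℝ H]

/-- Sequential Banach–Alaoglu in the dual, carried back by the Riesz isomorphism. -/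
theorem exists_subseq_weakly_convergent [TopologicalSpace.SeparableSpace V] {R : ℝ} {x : ℕ → V}
    (hx : ∀ n, ‖x n‖ ≤ R) :
    ∃ y : V, ‖y‖ ≤ R ∧ ∃ ns : ℕ → ℕ, StrictMono ns ∧
      ∀ z, Tendsto (fun n => inner ℝ (x (ns n)) z) atTop (𝓝 (inner ℝ y z)) := by
  have hc := WeakDual.isSeqCompact_closedBall ℝ V (0 : StrongDual ℝ V) R
  obtain ⟨ξ, hξ, ns, hns, hlim⟩ := hc
    (x := fun n => StrongDual.toWeakDual (InnerProductSpace.toDual ℝ V (x n)))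
    (fun n => by
      simpa using hx n)
  refine ⟨(InnerProductSpace.toDual ℝ V).symm (WeakDual.toStrongDual ξ), ?_, ns, hns, fun z => ?_⟩
  · simpa using hξ
  · have := (WeakDual.eval_continuous z).continuousAt.tendsto.comp hlim
    have e : inner ℝ ((InnerProductSpace.toDual ℝ V).symm (WeakDual.toStrongDual ξ)) z = ξ z :=
      InnerProductSpace.toDual_symm_apply
    rw [e]
    exact this

/-- A sequence in the unit ball has a weakly convergent subsequence; subtracting the limit gives a
bounded weakly null sequence, to which the hypothesis applies. -/
theorem isCompactOperator_of_tendsto_zero_of_weakly [TopologicalSpace.SeparableSpace V]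
    (ι : V →L[ℝ] H)
    (h : ∀ x : ℕ → V, (∃ R, ∀ n, ‖x n‖ ≤ R) →
      (∀ z, Tendsto (fun n => inner ℝ (x n) z) atTop (𝓝 0)) →
      Tendsto (fun n => ι (x n)) atTop (𝓝 0)) : IsCompactOperator ι := by
  refine (isCompactOperator_iff_image_closedBall_subset_compact (ι : V →ₗ[ℝ] H) one_pos).2
    ⟨ι '' Metric.closedBall 0 1, IsSeqCompact.isCompact fun u hu => ?_, subset_rfl⟩
  choose x hx hxu using hu
  obtain ⟨y, hy, ns, hns, hlim⟩ := exists_subseq_weakly_convergent (R := 1) (x := x)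
    (fun n => by simpa using hx n)
  refine ⟨ι y, ⟨y, by simpa using hy, rfl⟩, ns, hns, ?_⟩
  have := h (fun n => x (ns n) - y) ⟨1 + 1, fun n => (norm_sub_le _ _).trans
    (add_le_add (by simpa using hx (ns n)) hy)⟩ (fun z => by
      have := (hlim z).sub_const (inner ℝ y z)
      simpa [inner_sub_left] using this)
  have h2 := this.add_const (ι y)
  simp only [map_sub, sub_add_cancel, zero_add] at h2
  refine h2.congr fun n => hxu (ns n)

/-- Order S by decreasing f, breaking ties by an arbitrary linear order. Each element has finitely
many predecessors; their number is an injective rank, and the infinite set of ranks is enumerated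
increasingly. -/
theorem exists_equiv_nat_antitone {S : Type*} [Infinite S] (f : S → ℝ)
    (hf : ∀ s, {t | f s ≤ f t}.Finite) : ∃ e : ℕ ≃ S, Antitone (f ∘ e) := by
  classical
  let : LinearOrder S := linearOrderOfSTO WellOrderingRel
  let key : S → ℝᵒᵈ ×ₗ S := fun s => toLex (OrderDual.toDual (f s), s)
  have key_inj : Function.Injective key := fun s t h => congrArg (fun p => (ofLex p).2) h
  have key_le : ∀ {s t}, key s ≤ key t → f t ≤ f s := fun {s t} h => by
    rcases (Prod.Lex.le_iff).1 h with h | h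
    · exact le_of_lt h
    · exact le_of_eq h.1.symm
  have fin : ∀ s, {t | key t < key s}.Finite := fun s =>
    (hf s).subset fun t ht => key_le (le_of_lt ht)
  let r : S → ℕ := fun s => {t | key t < key s}.ncard
  have r_mono : ∀ {s t}, key s < key t → r s < r t := fun {s t} h =>
    Set.ncard_lt_ncard ⟨fun u hu => lt_trans hu h,
      fun hsub => lt_irrefl (key s) (show key s < key s from hsub h)⟩ (fin t)
  have r_le : ∀ {s t}, r s ≤ r t → key s ≤ key t := fun {s t} h => by
    by_contra hlt
    exact absurd h (not_le.2 (r_mono (not_le.1 hlt)))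
  have r_inj : Function.Injective r := fun s t h =>
    key_inj (le_antisymm (r_le h.le) (r_le h.ge))
  have : Infinite (Set.range r) := Set.infinite_coe_iff.2 (Set.infinite_range_of_injective r_inj)
  let o := Nat.Subtype.orderIsoOfNat (Set.range r)
  refine ⟨o.toEquiv.trans (Equiv.ofInjective r r_inj).symm, fun m n hmn => ?_⟩
  refine key_le (r_le ?_)
  have key_eq : ∀ k, r ((Equiv.ofInjective r r_inj).symm (o k)) = (o k : ℕ) := fun k => by
    have := Equiv.apply_symm_apply (Equiv.ofInjective r r_inj) (o k)
    exact congrArg Subtype.val this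
  simp only [Equiv.trans_apply, RelIso.coe_fn_toEquiv]
  rw [key_eq, key_eq]
  exact o.monotone hmn

/-- Points of a compact set that are `ε`-separated form a finite family. -/
theorem finite_of_isCompact_of_separated {S X : Type*} [PseudoMetricSpace X] {K : Set X}
    (hK : IsCompact K) {ε : ℝ} (hε : 0 < ε) (f : S → X) (hf : ∀ s, f s ∈ K)
    (hsep : Pairwise fun s t => ε ≤ dist (f s) (f t)) : Finite S := by
  by_contra hS
  rw [not_finite_iff_infinite] at hS
  let g := Infinite.natEmbedding S
  obtain ⟨a, -, ns, hns, hlim⟩ := hK.isSeqCompact (x := fun n => f (g n)) fun n => hf _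
  have hc := hlim.cauchySeq
  obtain ⟨N, hN⟩ := Metric.cauchySeq_iff.1 hc ε hε
  have h1 := hN N le_rfl (N + 1) (Nat.le_succ N)
  have h2 := hsep (i := g (ns N)) (j := g (ns (N + 1))) fun h =>
    absurd (hns.injective (g.injective h)) (by omega)
  exact absurd h1 (not_lt.2 h2)

/-- The spectral theorem gives complete orthogonal eigenspaces. Positivity removes the kernel, so
every eigenspace is finite-dimensional and the union of their orthonormal bases can be listed by
decreasing eigenvalue. -/
theorem exists_hilbertBasis_eigenvectors [CompleteSpace H] (hinf : ¬ FiniteDimensional ℝ H)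
    (T : H →L[ℝ] H) (hT : IsCompactOperator T) (hsym : (T : H →ₗ[ℝ] H).IsSymmetric)
    (hpos : ∀ x, x ≠ 0 → 0 < inner ℝ (T x) x) :
    ∃ (b : HilbertBasis ℕ ℝ H) (m : ℕ → ℝ), Antitone m ∧ (∀ k, 0 < m k) ∧
      ∀ k, T (b k) = m k • b k := by
  classical
  let E := fun μ : Module.End.Eigenvalues (T : H →ₗ[ℝ] H) =>
    Module.End.eigenspace (T : H →ₗ[ℝ] H) (μ : ℝ)
  have hmpos : ∀ μ : Module.End.Eigenvalues (T : H →ₗ[ℝ] H), 0 < (μ : ℝ) := fun μ => by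
    obtain ⟨v, hv⟩ := Module.End.HasEigenvalue.exists_hasEigenvector μ.2
    have h1 := hpos v hv.2
    have h2 : T v = (μ : ℝ) • v := hv.apply_eq_smul
    rw [h2, real_inner_smul_left, real_inner_self_eq_norm_sq] at h1
    exact pos_of_mul_pos_left h1 (sq_nonneg _)
  have hfd : ∀ μ, FiniteDimensional ℝ (E μ) := fun μ =>
    ContinuousLinearMap.finite_dimensional_eigenspace hT _ (hmpos μ).ne'
  let S := Σ μ : Module.End.Eigenvalues (T : H →ₗ[ℝ] H), Fin (Module.finrank ℝ (E μ))
  let v : S → H := fun s => (stdOrthonormalBasis ℝ (E s.1) s.2 : H)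
  have horth : Orthonormal ℝ v := by
    have h1 := (hsym.orthogonalFamily_eigenspaces).comp
      (γ := Module.End.Eigenvalues (T : H →ₗ[ℝ] H)) (f := fun μ => (μ : ℝ))
      Subtype.val_injective
    exact h1.orthonormal_sigma_orthonormal (v_family := fun μ i => stdOrthonormalBasis ℝ (E μ) i)
      fun μ => (stdOrthonormalBasis ℝ (E μ)).orthonormal
  have heig : ∀ s : S, T (v s) = (s.1 : ℝ) • v s := fun s =>
    Module.End.mem_eigenspace_iff.1 (stdOrthonormalBasis ℝ (E s.1) s.2).2
  have hspan : (Submodule.span ℝ (Set.range v))ᗮ = ⊥ := by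
    rw [eq_bot_iff]
    have hb := ContinuousLinearMap.orthogonalComplement_iSup_eigenspaces_eq_bot hT hsym
    rw [← hb]
    refine Submodule.orthogonal_le (iSup_le fun μ => ?_)
    by_cases hμ : Module.End.eigenspace (T : H →ₗ[ℝ] H) μ = ⊥
    · rw [hμ]
      exact bot_le
    · let μ' : Module.End.Eigenvalues (T : H →ₗ[ℝ] H) := ⟨μ, hμ⟩
      intro x hx
      have hx' := (stdOrthonormalBasis ℝ (E μ')).sum_repr ⟨x, hx⟩
      have hx'' := congrArg (Subtype.val) hx'
      simp only [Submodule.coe_sum, Submodule.coe_smul] at hx''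
      rw [← hx'']
      exact Submodule.sum_mem _ fun i _ => Submodule.smul_mem _ _
        (Submodule.subset_span ⟨⟨μ', i⟩, rfl⟩)
  let B := HilbertBasis.mkOfOrthogonalEqBot horth hspan
  have : Infinite S := by
    by_contra hfin
    rw [not_infinite_iff_finite] at hfin
    have := Fintype.ofFinite S
    exact hinf (Module.Basis.finiteDimensional_of_finite (B.toOrthonormalBasis).toBasis)
  obtain ⟨K, hK, hKsub⟩ :=
    (isCompactOperator_iff_image_closedBall_subset_compact (T : H →ₗ[ℝ] H) one_pos).1 hT
  -- Only finitely many basis vectors have eigenvalue at least c > 0: by orthogonality their images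
  -- under T are c-separated, and they lie in a compact set.
  obtain ⟨e, he⟩ := exists_equiv_nat_antitone (fun s : S => (s.1 : ℝ)) fun s => by
    have hs := hmpos s.1
    have : Finite {t : S | (s.1 : ℝ) ≤ t.1} := by
      refine finite_of_isCompact_of_separated hK hs (fun t => T (v t)) (fun t => hKsub
        ⟨v t, by simp [horth.norm_eq_one], rfl⟩) fun t t' htt' => ?_
      have ho : inner ℝ (v t) (v t') = 0 := horth.2 fun h => htt' (Subtype.ext h)
      have h1 : ‖T (v t) - T (v t')‖ ^ 2 = ((t : S).1 : ℝ) ^ 2 + ((t' : S).1 : ℝ) ^ 2 := by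
        rw [heig, heig, norm_sub_sq_real, real_inner_smul_left, real_inner_smul_right, ho,
          norm_smul, norm_smul, horth.norm_eq_one, horth.norm_eq_one]
        simp
      have ht : (s.1 : ℝ) ≤ (t : S).1 := t.2
      change (s.1 : ℝ) ≤ dist (T (v t)) (T (v t'))
      rw [dist_eq_norm]
      refine le_of_sq_le_sq ?_ (norm_nonneg _)
      rw [h1]
      nlinarith [sq_nonneg ((t' : S).1 : ℝ)]
    exact Set.toFinite _
  have hrange : Set.range (v ∘ e) = Set.range v := by
    rw [Set.range_comp, e.surjective.range_eq, Set.image_univ]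
  refine ⟨HilbertBasis.mkOfOrthogonalEqBot (horth.comp e e.injective) (by rw [hrange, hspan]),
    fun k => ((e k).1 : ℝ), he, fun k => hmpos _, fun k => ?_⟩
  rw [HilbertBasis.coe_mkOfOrthogonalEqBot]
  exact heig (e k)

/-- Spectral decomposition of `J J*` for a compact operator `J` with dense range. -/
theorem exists_hilbertBasis_comp_adjoint [CompleteSpace H] (hinf : ¬ FiniteDimensional ℝ H)
    (J : V →L[ℝ] H) (hJ : IsCompactOperator J) (hinj : ∀ f, J.adjoint f = 0 → f = 0) :
    ∃ (b : HilbertBasis ℕ ℝ H) (m : ℕ → ℝ), Antitone m ∧ (∀ k, 0 < m k) ∧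
      ∀ k, ∃ p : V, J p = b k ∧ ∀ q : V, inner ℝ p q = (m k)⁻¹ * inner ℝ (b k) (J q) := by
  have hinner : ∀ f g, inner ℝ ((J ∘L J.adjoint) f) g = inner ℝ (J.adjoint f) (J.adjoint g) :=
    fun f g => by
      rw [ContinuousLinearMap.comp_apply, ContinuousLinearMap.adjoint_inner_right]
  have hsym : ((J ∘L J.adjoint : H →L[ℝ] H) : H →ₗ[ℝ] H).IsSymmetric := fun f g => by
    change inner ℝ ((J ∘L J.adjoint) f) g = inner ℝ f ((J ∘L J.adjoint) g)
    rw [hinner, real_inner_comm _ f, hinner, real_inner_comm]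
  have hpos : ∀ f, f ≠ 0 → 0 < inner ℝ ((J ∘L J.adjoint) f) f := fun f hf => by
    rw [hinner, real_inner_self_eq_norm_sq]
    have : J.adjoint f ≠ 0 := fun h => hf (hinj f h)
    positivity
  obtain ⟨b, m, hanti, hm, hb⟩ := exists_hilbertBasis_eigenvectors hinf (J ∘L J.adjoint)
    (hJ.comp_clm J.adjoint) hsym hpos
  -- The lift of b_k to V is J* b_k / m_k; moving J* to the other side gives the weak form of the
  -- eigenvalue equation.
  refine ⟨b, m, hanti, hm, fun k => ⟨(m k)⁻¹ • J.adjoint (b k), ?_, fun q => ?_⟩⟩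
  · have := hb k
    rw [ContinuousLinearMap.comp_apply] at this
    rw [map_smul, this, smul_smul, inv_mul_cancel₀ (hm k).ne', one_smul]
  · rw [real_inner_smul_left, ContinuousLinearMap.adjoint_inner_left]

theorem hasSum_inner_sq (b : HilbertBasis ℕ ℝ H) (x : H) :
    HasSum (fun k => inner ℝ x (b k) ^ 2) (‖x‖ ^ 2) := by
  have h := b.hasSum_inner_mul_inner x x
  rw [real_inner_self_eq_norm_sq] at h
  have e : (fun k => inner ℝ x (b k) * inner ℝ (b k) x) = fun k => inner ℝ x (b k) ^ 2 := by
    ext k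
    rw [real_inner_comm x (b k), sq]
  rwa [e] at h

/-- Ellipsoids with semiaxes tending to zero are relatively compact. -/
theorem exists_subseq_tendsto_of_weighted_bound [CompleteSpace H] (b : HilbertBasis ℕ ℝ H)
    {w : ℕ → ℝ} (hw0 : ∀ k, 0 ≤ w k) (hw : Tendsto w atTop atTop) {R : ℝ} {M : ℝ}
    {x : ℕ → H} (hx : ∀ n, ‖x n‖ ≤ R)
    (hsum : ∀ n, Summable fun k => w k * inner ℝ (x n) (b k) ^ 2)
    (hle : ∀ n, ∑' k, w k * inner ℝ (x n) (b k) ^ 2 ≤ M) :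
    ∃ y : H, ∃ ns : ℕ → ℕ, StrictMono ns ∧ Tendsto (fun n => x (ns n)) atTop (𝓝 y) := by
  have hM : 0 ≤ M := (tsum_nonneg fun k => mul_nonneg (hw0 k) (sq_nonneg _)).trans (hle 0)
  -- Compactness of the product of intervals replaces a diagonal argument: along a subsequence all
  -- coordinates converge.
  have hK : IsCompact (Set.univ.pi fun _ : ℕ => Set.Icc (-R) R) :=
    isCompact_univ_pi fun _ => isCompact_Icc
  obtain ⟨c, -, ns, hns, hc⟩ := hK.isSeqCompact (x := fun n k => inner ℝ (x n) (b k))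
    fun n k _ => abs_le.1 <| (abs_real_inner_le_norm _ _).trans (by
      rw [b.orthonormal.norm_eq_one, mul_one]
      exact hx n)
  rw [tendsto_pi_nhds] at hc
  suffices hcau : CauchySeq fun n => x (ns n) by
    obtain ⟨y, hy⟩ := cauchySeq_tendsto_of_complete hcau
    exact ⟨y, ns, hns, hy⟩
  rw [cauchySeq_iff_tendsto_dist_atTop_0, Metric.tendsto_nhds]
  intro ε hε
  -- Beyond N the tail of ‖x - x'‖² is at most (2/W)(M + M) < ε²/2, where W is this threshold; M + 1
  -- keeps W positive when M = 0.
  obtain ⟨N, hN⟩ := eventually_atTop.1 (hw.eventually_ge_atTop (8 * (M + 1) / ε ^ 2))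
  set W := 8 * (M + 1) / ε ^ 2 with hWdef
  have hW : 0 < W := by positivity
  have hF : Tendsto (fun p : ℕ × ℕ => ∑ k ∈ Finset.range N,
      (inner ℝ (x (ns p.1)) (b k) - inner ℝ (x (ns p.2)) (b k)) ^ 2) atTop (𝓝 0) := by
    have : (0 : ℝ) = ∑ k ∈ Finset.range N, (c k - c k) ^ 2 := by simp
    rw [this, ← prod_atTop_atTop_eq]
    exact tendsto_finsetSum _ fun k _ =>
      (((hc k).comp tendsto_fst).sub ((hc k).comp tendsto_snd)).pow 2
  filter_upwards [hF.eventually (gt_mem_nhds (show 0 < ε ^ 2 / 2 by positivity))] with p hp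
  have hs := hasSum_inner_sq b (x (ns p.1) - x (ns p.2))
  have h1 := (hsum (ns p.1)).hasSum
  have h2 := (hsum (ns p.2)).hasSum
  have hfin := hasSum_sum_of_ne_finset_zero (L := SummationFilter.unconditional ℕ) (s := Finset.range N)
    (f := fun k => if k < N then
      (inner ℝ (x (ns p.1)) (b k) - inner ℝ (x (ns p.2)) (b k)) ^ 2 else (0 : ℝ))
    fun k hk => if_neg (by simpa using hk)
  have hbound := hasSum_le (fun k => ?_) hs (hfin.add ((h1.add h2).mul_left (2 / W)))
  · rw [Finset.sum_congr rfl (g := fun k =>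
      (inner ℝ (x (ns p.1)) (b k) - inner ℝ (x (ns p.2)) (b k)) ^ 2)
      fun k hk => if_pos (Finset.mem_range.1 hk)] at hbound
    have h3 : 2 / W * (M + M) < ε ^ 2 / 2 := by
      rw [hWdef]
      field_simp
      linarith
    have h4 : 2 / W * (∑' k, w k * inner ℝ (x (ns p.1)) (b k) ^ 2 +
        ∑' k, w k * inner ℝ (x (ns p.2)) (b k) ^ 2) ≤ 2 / W * (M + M) := by
      have := hle (ns p.1)
      have := hle (ns p.2)
      gcongr
    rw [Real.dist_eq, sub_zero, abs_of_nonneg dist_nonneg, dist_eq_norm]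
    exact lt_of_pow_lt_pow_left₀ 2 hε.le (by linarith)
  · simp only [inner_sub_left]
    split_ifs with hk
    · have : 0 ≤ 2 / W * (w k * inner ℝ (x (ns p.1)) (b k) ^ 2 +
          w k * inner ℝ (x (ns p.2)) (b k) ^ 2) := by
        have := hw0 k
        positivity
      linarith
    · have h5 : W ≤ w k := hN k (not_lt.1 hk)
      rw [zero_add, ← mul_add, div_mul_eq_mul_div, le_div_iff₀ hW]
      nlinarith [mul_le_mul_of_nonneg_right h5 (sq_nonneg (inner ℝ (x (ns p.1)) (b k))),
        mul_le_mul_of_nonneg_right h5 (sq_nonneg (inner ℝ (x (ns p.2)) (b k))),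
        mul_nonneg hW.le (sq_nonneg (inner ℝ (x (ns p.1)) (b k) + inner ℝ (x (ns p.2)) (b k)))]

end HilbertSpace

/-! ### Test functions and the translation estimate for H¹ functions. -/

section Translation

variable {d : ℕ} {Ω A : Set (Euc d)}

/-- Smooth functions with compact support in `A`. -/
structure IsTest (A : Set (Euc d)) (φ : Euc d → ℝ) : Prop where
  contDiff : ContDiff ℝ ∞ φ
  hasCompactSupport : HasCompactSupport φ
  tsupport_subset : tsupport φ ⊆ A

theorem IsTest.zero : IsTest A (0 : Euc d → ℝ) :=
  ⟨contDiff_const, HasCompactSupport.zero, by simp⟩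

theorem IsTest.add {φ ψ : Euc d → ℝ} (h : IsTest A φ) (h' : IsTest A ψ) : IsTest A (φ + ψ) :=
  ⟨h.1.add h'.1, h.2.add h'.2,
    (tsupport_add φ ψ).trans (Set.union_subset h.3 h'.3)⟩

theorem IsTest.const_smul {φ : Euc d → ℝ} (h : IsTest A φ) (c : ℝ) : IsTest A (c • φ) :=
  ⟨h.1.const_smul c, h.2.smul_left (f := fun _ => c),
    (tsupport_smul_subset_right (fun _ => c) φ).trans h.3⟩

theorem IsTest.memLp {φ : Euc d → ℝ} (h : IsTest A φ) (p : ℝ≥0∞) (μ : Measure (Euc d))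
    [IsFiniteMeasure μ] : MemLp φ p μ :=
  h.1.continuous.memLp_of_hasCompactSupport h.2

/-- Translates of test functions. -/
theorem IsTest.comp_sub {φ : Euc d → ℝ} (h : IsTest A φ) (c : Euc d)
    (hc : ∀ x ∈ A, x + c ∈ Ω) : IsTest Ω fun x => φ (x - c) := by
  refine ⟨h.1.comp (contDiff_id.sub contDiff_const),
    h.2.comp_homeomorph (Homeomorph.subRight c), ?_⟩
  have : tsupport (fun x => φ (x - c)) ⊆ (fun x => x - c) ⁻¹' tsupport φ :=
    tsupport_comp_subset_preimage φ (by fun_prop)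
  intro x hx
  simpa using hc _ (h.3 (this hx))

/-- The subspace of `L²` of classes of test functions. -/
def testSubmodule (A : Set (Euc d)) (μ : Measure (Euc d)) : Submodule ℝ (Lp ℝ 2 μ) where
  carrier := {g | ∃ φ, IsTest A φ ∧ g =ᵐ[μ] φ}
  add_mem' := by
    rintro f g ⟨φ, hφ, hf⟩ ⟨ψ, hψ, hg⟩
    exact ⟨φ + ψ, hφ.add hψ, (Lp.coeFn_add f g).trans (hf.add hg)⟩
  zero_mem' := ⟨0, IsTest.zero, Lp.coeFn_zero _ _ _⟩
  smul_mem' := by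
    rintro c f ⟨φ, hφ, hf⟩
    exact ⟨c • φ, hφ.const_smul c, (Lp.coeFn_smul c f).trans (hf.const_smul c)⟩

/-- An element orthogonal to all test functions vanishes a.e. on A by the fundamental lemma of the
calculus of variations, and μ is carried by A. -/
theorem testSubmodule_topologicalClosure (hA : IsOpen A) (μ : Measure (Euc d)) [IsFiniteMeasure μ]
    (hμ : ∀ᵐ x ∂μ, x ∈ A) : (testSubmodule A μ).topologicalClosure = ⊤ := by
  rw [Submodule.topologicalClosure_eq_top_iff, eq_bot_iff]
  intro f hf
  rw [Submodule.mem_orthogonal] at hf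
  rw [Submodule.mem_bot, Lp.eq_zero_iff_ae_eq_zero]
  have hfi : Integrable f μ := (Lp.memLp f).integrable one_le_two
  have h := hA.ae_eq_zero_of_integral_contDiff_smul_eq_zero (f := f) (μ := μ)
    (hfi.locallyIntegrable.locallyIntegrableOn A) fun g hg hg' hgA => by
      have ht : IsTest A g := ⟨hg, hg', hgA⟩
      have := hf ((ht.memLp 2 μ).toLp g) ⟨g, ht, MemLp.coeFn_toLp _⟩
      rw [L2.inner_def] at this
      rw [← this]
      refine integral_congr_ae ?_
      filter_upwards [(ht.memLp 2 μ).coeFn_toLp] with x hx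
      rw [hx]
      simp [mul_comm]
  filter_upwards [h, hμ] with x hx hx'
  exact hx hx'

/-- Duality: by density the bound extends from test functions to all of L², where it may be applied
to f itself. -/
theorem eLpNorm_le_of_forall_test (hA : IsOpen A) (μ : Measure (Euc d)) [IsFiniteMeasure μ]
    (hμ : ∀ᵐ x ∂μ, x ∈ A) {f : Euc d → ℝ} (hf : MemLp f 2 μ) {C : ℝ}
    (h : ∀ φ, IsTest A φ → |∫ x, f x * φ x ∂μ| ≤ C * (eLpNorm φ 2 μ).toReal) :
    eLpNorm f 2 μ ≤ ENNReal.ofReal C := by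
  set F := hf.toLp f
  have hcl : IsClosed {g : Lp ℝ 2 μ | |inner ℝ F g| ≤ C * ‖g‖} :=
    isClosed_le (by fun_prop) (by fun_prop)
  have hsub : (testSubmodule A μ : Set (Lp ℝ 2 μ)) ⊆ {g | |inner ℝ F g| ≤ C * ‖g‖} := by
    rintro g ⟨φ, hφ, hg⟩
    have h1 := h φ hφ
    rw [← eLpNorm_congr_ae hg] at h1
    rw [Set.mem_ofPred_eq, Lp.norm_def, L2.inner_def]
    convert h1 using 2
    refine integral_congr_ae ?_
    filter_upwards [hf.coeFn_toLp, hg] with x hx hx'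
    rw [hx, hx']
    simp [mul_comm]
  have hmem : F ∈ ((testSubmodule A μ).topologicalClosure : Set (Lp ℝ 2 μ)) := by
    rw [testSubmodule_topologicalClosure hA μ hμ]
    trivial
  have hF : |inner ℝ F F| ≤ C * ‖F‖ := closure_minimal hsub hcl hmem
  rw [real_inner_self_eq_norm_sq, abs_of_nonneg (sq_nonneg _), sq] at hF
  rcases eq_or_ne ‖F‖ 0 with h0 | h0
  · have : eLpNorm f 2 μ = 0 := by
      rw [← eLpNorm_congr_ae hf.coeFn_toLp, ← Lp.enorm_def, ← ofReal_norm]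
      change ENNReal.ofReal ‖F‖ = 0
      rw [h0, ENNReal.ofReal_zero]
    rw [this]
    exact zero_le
  · have h1 : ‖F‖ ≤ C := le_of_mul_le_mul_right hF (lt_of_le_of_ne (norm_nonneg _) h0.symm)
    rw [← eLpNorm_congr_ae hf.coeFn_toLp, ← Lp.enorm_def, ← ofReal_norm]
    exact ENNReal.ofReal_le_ofReal h1

theorem IsH1.integral_fderiv {u : Euc d → ℝ} {G : Euc d → Euc d} (hu : IsH1 Ω u G)
    {φ : Euc d → ℝ} (hφ : IsTest Ω φ) (h : Euc d) :
    ∫ x in Ω, u x * fderiv ℝ φ x h = -∫ x in Ω, φ x * inner ℝ (G x) h := by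
  have hw := congrArg (inner ℝ h) (hu.weak_grad φ hφ.1 hφ.2 hφ.3)
  have hul : LocallyIntegrable u (volume.restrict Ω) := hu.memLp.locallyIntegrable one_le_two
  have hGl : LocallyIntegrable G (volume.restrict Ω) := hu.memLp_grad.locallyIntegrable one_le_two
  have hgc : Continuous (gradient φ) :=
    (LinearIsometryEquiv.continuous _).comp (hφ.1.continuous_fderiv (by simp))
  have hgs : HasCompactSupport (gradient φ) :=
    (hφ.2.fderiv (𝕜 := ℝ)).comp_left (map_zero _)
  rw [inner_neg_right, ← integral_inner
    (hGl.integrable_smul_left_of_hasCompactSupport hφ.1.continuous hφ.2),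
    ← integral_inner (hul.integrable_smul_right_of_hasCompactSupport hgc hgs)] at hw
  have e1 : ∀ x, inner ℝ h (u x • gradient φ x) = u x * fderiv ℝ φ x h := fun x => by
    rw [inner_smul_right, real_inner_comm, gradient, InnerProductSpace.toDual_symm_apply]
  have e2 : ∀ x, inner ℝ h (φ x • G x) = φ x * inner ℝ (G x) h := fun x => by
    rw [inner_smul_right, real_inner_comm]
  simpa only [e1, e2] using hw

theorem integral_norm_mul_norm_le {X E F : Type*} [MeasurableSpace X] [NormedAddCommGroup E]
    [NormedAddCommGroup F] {μ : Measure X} {f : X → E} {g : X → F} (hf : MemLp f 2 μ)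
    (hg : MemLp g 2 μ) :
    ∫ x, ‖f x‖ * ‖g x‖ ∂μ ≤ (eLpNorm f 2 μ).toReal * (eLpNorm g 2 μ).toReal := by
  have h := real_inner_le_norm (hf.norm.toLp _) (hg.norm.toLp _)
  rw [L2.inner_def, Lp.norm_toLp, Lp.norm_toLp, eLpNorm_norm, eLpNorm_norm] at h
  refine le_trans (le_of_eq (integral_congr_ae ?_)) h
  filter_upwards [hf.norm.coeFn_toLp, hg.norm.coeFn_toLp] with x hx hx'
  rw [hx, hx']
  simp [mul_comm]

/-- `|∫ u (φ(· - h) - φ)| ≤ |h| ‖∇u‖ ‖φ‖` as long as the support of `φ` stays in `Ω` when it is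
moved along the segment from `0` to `h`. -/
theorem IsH1.abs_integral_translate_le [IsFiniteMeasure (volume.restrict Ω)]
    {u : Euc d → ℝ} {G : Euc d → Euc d} (hu : IsH1 Ω u G) {φ : Euc d → ℝ}
    (hφ : IsTest A φ) (h : Euc d) (hA : ∀ x ∈ A, ∀ t ∈ Set.Icc (0 : ℝ) 1, x + t • h ∈ Ω) :
    |(∫ x in Ω, u x * φ (x - h)) - ∫ x in Ω, u x * φ x| ≤
      ‖h‖ * (eLpNorm G 2 (volume.restrict Ω)).toReal * (eLpNorm φ 2 volume).toReal := by
  have hui : Integrable u (volume.restrict Ω) := hu.memLp.integrable one_le_two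
  obtain ⟨C, hC⟩ := (hφ.1.continuous_fderiv (by simp)).bounded_above_of_compact_support
    (hφ.2.fderiv (𝕜 := ℝ))
  obtain ⟨B, hB⟩ := hφ.1.continuous.bounded_above_of_compact_support hφ.2
  have hdφ : ∀ x, HasFDerivAt φ (fderiv ℝ φ x) x := fun x =>
    (hφ.1.differentiable (by simp) x).hasFDerivAt
  -- Differentiate in the translation parameter t. The weak gradient turns the derivative into an
  -- integral of G against the translated test function, Cauchy–Schwarz bounds it, and the mean
  -- value inequality on [0, 1] concludes.
  have hderiv : ∀ t : ℝ, HasDerivAt (fun t : ℝ => ∫ x in Ω, u x * φ (x - t • h))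
      (∫ x in Ω, u x * -(fderiv ℝ φ (x - t • h) h)) t := fun t => by
    refine (hasDerivAt_integral_of_dominated_loc_of_deriv_le (s := Set.univ)
      (F' := fun t x => u x * -(fderiv ℝ φ (x - t • h) h))
      (bound := fun x => ‖u x‖ * (C * ‖h‖)) Filter.univ_mem ?_ ?_ ?_ ?_ ?_ ?_).2
    · refine Filter.Eventually.of_forall fun s => ?_
      exact hui.aestronglyMeasurable.mul
        (hφ.1.continuous.comp (by fun_prop)).aestronglyMeasurable
    · refine hui.mul_bdd (c := B) (hφ.1.continuous.comp (by fun_prop)).aestronglyMeasurable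
        (Filter.Eventually.of_forall fun x => hB _)
    · refine hui.aestronglyMeasurable.mul (Continuous.aestronglyMeasurable ?_)
      have := hφ.1.continuous_fderiv (by simp)
      fun_prop
    · refine Filter.Eventually.of_forall fun x s _ => ?_
      rw [norm_mul, norm_neg]
      gcongr
      exact (ContinuousLinearMap.le_opNorm _ _).trans (by gcongr; exact hC _)
    · exact hui.norm.mul_const _
    · refine Filter.Eventually.of_forall fun x s _ => ?_
      have h1 : HasDerivAt (fun t : ℝ => x - t • h) (-h) s := by
        simpa using ((hasDerivAt_id s).smul_const h).const_sub x
      have h2 := (hdφ (x - s • h)).comp_hasDerivAt s h1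
      rw [map_neg] at h2
      exact h2.const_mul _
  have hbound : ∀ t ∈ Set.Ico (0 : ℝ) 1, ‖∫ x in Ω, u x * -(fderiv ℝ φ (x - t • h) h)‖ ≤
      ‖h‖ * (eLpNorm G 2 (volume.restrict Ω)).toReal * (eLpNorm φ 2 volume).toReal := by
    intro t ht
    have htest : IsTest Ω fun x => φ (x - t • h) :=
      hφ.comp_sub (t • h) fun x hx => hA x hx t ⟨ht.1, ht.2.le⟩
    have hfd : ∀ x, fderiv ℝ (fun x => φ (x - t • h)) x = fderiv ℝ φ (x - t • h) := fun x =>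
      fderiv_comp_sub _
    have h1 := hu.integral_fderiv htest h
    simp only [hfd] at h1
    simp only [mul_neg, integral_neg, h1, neg_neg]
    have h2 : ∀ x, ‖φ (x - t • h) * inner ℝ (G x) h‖ ≤ ‖h‖ * (‖φ (x - t • h)‖ * ‖G x‖) := by
      intro x
      rw [norm_mul]
      calc ‖φ (x - t • h)‖ * ‖inner ℝ (G x) h‖ ≤ ‖φ (x - t • h)‖ * (‖G x‖ * ‖h‖) := by
            gcongr
            exact norm_inner_le_norm _ _
        _ = _ := by ring
    have hmem : MemLp (fun x => φ (x - t • h)) 2 (volume.restrict Ω) := htest.memLp 2 _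
    have hint : Integrable (fun x => ‖φ (x - t • h)‖ * ‖G x‖) (volume.restrict Ω) :=
      hmem.norm.integrable_mul hu.memLp_grad.norm
    have hnorm : (eLpNorm (fun x => φ (x - t • h)) 2 (volume.restrict Ω)).toReal ≤
        (eLpNorm φ 2 volume).toReal := by
      rw [← eLpNorm_comp_measurePreserving hφ.1.continuous.aestronglyMeasurable
        (measurePreserving_sub_right volume (t • h))]
      refine ENNReal.toReal_mono ?_ (eLpNorm_mono_measure _ Measure.restrict_le_self)
      exact (htest.1.continuous.memLp_of_hasCompactSupport htest.2).eLpNorm_ne_top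
    calc _ ≤ ∫ x in Ω, ‖φ (x - t • h) * inner ℝ (G x) h‖ := norm_integral_le_integral_norm _
      _ ≤ ∫ x in Ω, ‖h‖ * (‖φ (x - t • h)‖ * ‖G x‖) :=
          integral_mono_of_nonneg (Filter.Eventually.of_forall fun x => norm_nonneg _)
            (hint.const_mul _) (Filter.Eventually.of_forall h2)
      _ = ‖h‖ * ∫ x in Ω, ‖φ (x - t • h)‖ * ‖G x‖ := integral_const_mul _ _
      _ ≤ ‖h‖ * ((eLpNorm φ 2 volume).toReal * (eLpNorm G 2 (volume.restrict Ω)).toReal) := by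
          gcongr
          exact (integral_norm_mul_norm_le hmem hu.memLp_grad).trans (by gcongr)
      _ = _ := by ring
  have := norm_image_sub_le_of_norm_deriv_le_segment_01'
    (f := fun t : ℝ => ∫ x in Ω, u x * φ (x - t • h))
    (fun t _ => (hderiv t).hasDerivWithinAt) hbound
  simpa using this

/-- The dual of the preceding estimate: paired with a test function supported in A, the translation
of u moves onto the test function. No smooth approximation of u is needed. -/
theorem IsH1.eLpNorm_translate_sub_le [IsFiniteMeasure (volume.restrict Ω)] (hΩ : IsOpen Ω)
    {u : Euc d → ℝ} {G : Euc d → Euc d} (hu : IsH1 Ω u G) (hA : IsOpen A) (h : Euc d)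
    (hseg : ∀ x ∈ A, ∀ t ∈ Set.Icc (0 : ℝ) 1, x + t • h ∈ Ω) :
    eLpNorm (fun x => u (x + h) - u x) 2 (volume.restrict A) ≤
      ‖h‖ₑ * eLpNorm G 2 (volume.restrict Ω) := by
  have hAΩ : A ⊆ Ω := fun x hx => by simpa using hseg x hx 0 (by simp)
  have hAh : ∀ x ∈ A, x + h ∈ Ω := fun x hx => by simpa using hseg x hx 1 (by simp)
  have hle : volume.restrict A ≤ volume.restrict Ω := Measure.restrict_mono hAΩ le_rfl
  have : IsFiniteMeasure (volume.restrict A) := isFiniteMeasure_of_le _ hle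
  have hm1 : MemLp u 2 (volume.restrict A) := hu.memLp.mono_measure hle
  have hm2 : MemLp (fun x => u (x + h)) 2 (volume.restrict A) := by
    have hmp := (measurePreserving_add_right volume h).restrict_preimage
      (s := Ω) hΩ.measurableSet
    exact (hu.memLp.comp_measurePreserving hmp).mono_measure (Measure.restrict_mono hAh le_rfl)
  have key := eLpNorm_le_of_forall_test hA (volume.restrict A)
    (ae_restrict_mem hA.measurableSet) (hm2.sub hm1)
    (C := ‖h‖ * (eLpNorm G 2 (volume.restrict Ω)).toReal) fun φ hφ => ?_
  · rwa [ENNReal.ofReal_mul (norm_nonneg _), ENNReal.ofReal_toReal hu.memLp_grad.eLpNorm_ne_top,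
      ofReal_norm] at key
  · have hmφ : MemLp φ 2 (volume.restrict A) := hφ.memLp 2 _
    have hsupp : ∀ x, x ∉ A → φ x = 0 := fun x hx =>
      image_eq_zero_of_notMem_tsupport fun hx' => hx (hφ.3 hx')
    have hb := hu.abs_integral_translate_le hφ h hseg
    rw [eLpNorm_restrict_eq_of_support_subset (s := A) fun x hx => by
      by_contra hx'
      exact hx (hsupp x hx')]
    convert hb using 2
    have e1 : ∫ x in Ω, u x * φ (x - h) = ∫ x in A, u (x + h) * φ x := by
      rw [setIntegral_eq_integral_of_forall_compl_eq_zero,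
        setIntegral_eq_integral_of_forall_compl_eq_zero,
        ← integral_add_right_eq_self (fun x => u x * φ (x - h)) h]
      · simp
      · intro x hx
        rw [hsupp x hx, mul_zero]
      · intro x hx
        rw [hsupp (x - h) fun hx' => hx (by simpa using hAh _ hx'), mul_zero]
    have e2 : ∫ x in Ω, u x * φ x = ∫ x in A, u x * φ x := by
      rw [setIntegral_eq_integral_of_forall_compl_eq_zero,
        setIntegral_eq_integral_of_forall_compl_eq_zero]
      · intro x hx
        rw [hsupp x hx, mul_zero]
      · intro x hx
        rw [hsupp x fun hx' => hx (hAΩ hx'), mul_zero]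
    rw [e1, e2]
    refine Eq.trans ?_ (integral_sub (hm2.integrable_mul hmφ) (hm1.integrable_mul hmφ))
    refine integral_congr_ae (Filter.Eventually.of_forall fun x => ?_)
    simp only [Pi.sub_apply]
    ring

end Translation

/-! ### Local cones and Rellich's compactness theorem. -/

section Rellich

open Filter Metric

variable {d : ℕ} {Ω A K : Set (Euc d)}

/-- Near `x₀`, the set `Ω` contains with each of its points a translate of a fixed truncated cone
with axis `e`. -/
def HasLocalCone (Ω : Set (Euc d)) (x₀ : Euc d) : Prop :=
  ∃ r > 0, ∃ e : Euc d, ∃ δ > 0, ∃ s₀ > 0, ∀ x ∈ Ω ∩ ball x₀ r, ∀ w ∈ closedBall e δ,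
    ∀ s ∈ Set.Icc (0 : ℝ) s₀, x + s • w ∈ Ω

theorem hasLocalCone_of_mem (hΩ : IsOpen Ω) {x₀ : Euc d} (hx₀ : x₀ ∈ Ω) : HasLocalCone Ω x₀ := by
  obtain ⟨r, hr, hball⟩ := isOpen_iff.1 hΩ x₀ hx₀
  -- At an interior point the axis is 0 and the cone is a full ball of radius r/4.
  refine ⟨r / 2, half_pos hr, 0, 1, one_pos, r / 4, by positivity, fun x hx w hw s hs => hball ?_⟩
  have h1 : ‖x - x₀‖ < r / 2 := by simpa [dist_eq_norm] using hx.2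
  have h2 : ‖w‖ ≤ 1 := by simpa using hw
  have h3 : ‖s • w‖ ≤ r / 4 := by
    rw [norm_smul, Real.norm_of_nonneg hs.1]
    nlinarith [hs.1, hs.2, norm_nonneg w]
  rw [mem_ball, dist_eq_norm, show x + s • w - x₀ = (x - x₀) + s • w by abel]
  linarith [norm_add_le (x - x₀) (s • w)]

/-- Near x₀ the graph function has a slope bound L. A move by s(e + v) with ‖v‖ ≤ δ gains at least
s(1 - δ) in height, while the graph rises by at most Lsδ. The choice δ = 1/(L + 1) balances the two,
which suffices because the starting point is strictly above the graph. -/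
theorem HasC11Boundary.hasLocalCone (hΩ : HasC11Boundary Ω) {x₀ : Euc d}
    (hx₀ : x₀ ∈ frontier Ω) : HasLocalCone Ω x₀ := by
  obtain ⟨U, hU, e, he, g, hg, ⟨C, hC⟩, hgraph⟩ := hΩ x₀ hx₀
  obtain ⟨r', hr', hball⟩ := Metric.mem_nhds_iff.1 hU
  -- Half of the radius is reserved for the move, whose length is at most (r/2) · 2.
  obtain ⟨r, hr, rfl⟩ : ∃ r, 0 < r ∧ r' = 2 * r := ⟨r' / 2, by positivity, by ring⟩
  set P := (Submodule.span ℝ {e})ᗮ.orthogonalProjectionOnto with hP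
  have hPe : P e = 0 :=
    Submodule.orthogonalProjectionOnto_orthogonalComplement_singleton_eq_zero e
  have hPn : ∀ v, ‖P v‖ ≤ ‖v‖ := Submodule.norm_orthogonalProjectionOnto_apply_le _
  set L := ‖fderiv ℝ g (P x₀)‖ + C * (2 * r) with hL
  have hL0 : 0 ≤ L := by positivity
  have hlip : ∀ a ∈ ball (P x₀) (2 * r), ‖fderiv ℝ g a‖ ≤ L := fun a ha => by
    have h1 := hC.norm_sub_le a (P x₀)
    have h2 : ‖a - P x₀‖ < 2 * r := by simpa [dist_eq_norm] using ha
    have h3 : (C : ℝ) * ‖a - P x₀‖ ≤ C * (2 * r) := by gcongr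
    have h4 := norm_le_norm_add_norm_sub' (fderiv ℝ g a) (fderiv ℝ g (P x₀))
    linarith
  refine ⟨r, hr, e, 1 / (L + 1), by positivity, r / 2, by positivity, fun x hx w hw s hs => ?_⟩
  set δ := 1 / (L + 1) with hδ
  have hδ1 : δ ≤ 1 := by
    rw [hδ, div_le_one (by positivity)]
    linarith
  have hδL : L * δ + δ = 1 := by
    rw [hδ]
    field_simp
  obtain ⟨v, rfl⟩ : ∃ v, w = e + v := ⟨w - e, by abel⟩
  have hv : ‖v‖ ≤ δ := by simpa [dist_eq_norm] using hw
  have hs0 := hs.1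
  have hxr : ‖x - x₀‖ < r := by simpa [dist_eq_norm] using hx.2
  have hsw : ‖s • (e + v)‖ ≤ r := by
    rw [norm_smul, Real.norm_of_nonneg hs.1]
    have := norm_add_le e v
    nlinarith [hs.2, norm_nonneg (e + v)]
  have hxU : x ∈ U := hball (by rw [mem_ball, dist_eq_norm]; linarith)
  have hzball : x + s • (e + v) ∈ ball x₀ (2 * r) := by
    rw [mem_ball, dist_eq_norm, show x + s • (e + v) - x₀ = (x - x₀) + s • (e + v) by abel]
    linarith [norm_add_le (x - x₀) (s • (e + v))]
  have hPball : ∀ {z}, z ∈ ball x₀ (2 * r) → P z ∈ ball (P x₀) (2 * r) := fun {z} hz => by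
    rw [mem_ball, dist_eq_norm, ← map_sub]
    exact (hPn _).trans_lt (by simpa [dist_eq_norm] using hz)
  rw [hgraph _ (hball hzball)]
  have h1 := (hgraph x hxU).1 hx.1
  have h2 := Convex.norm_image_sub_le_of_norm_fderiv_le (𝕜 := ℝ) (fun a _ => hg a) hlip
    (convex_ball _ _) (hPball (z := x) (by rw [mem_ball, dist_eq_norm]; linarith)) (hPball hzball)
  have h3 : P (x + s • (e + v)) - P x = s • P v := by
    rw [← map_sub, add_sub_cancel_left, map_smul, map_add, hPe, zero_add]
  have h4 : ‖s • P v‖ ≤ s * δ := by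
    rw [norm_smul, Real.norm_of_nonneg hs0]
    gcongr
    exact (hPn v).trans hv
  rw [h3] at h2
  have h5 : g (P (x + s • (e + v))) - g (P x) ≤ L * (s * δ) :=
    (le_abs_self _).trans (h2.trans (by gcongr))
  have h6 : inner ℝ e (x + s • (e + v)) = inner ℝ e x + s * (1 + inner ℝ e v) := by
    rw [inner_add_right, inner_smul_right, inner_add_right, real_inner_self_eq_norm_sq, he]
    ring
  have h7 : -δ ≤ inner ℝ e v := by
    have := abs_le.1 (abs_real_inner_le_norm e v)
    rw [he, one_mul] at this
    linarith [this.1]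
  rw [h6]
  nlinarith [mul_le_mul_of_nonneg_left h7 hs0]

theorem IsC11Domain.hasLocalCone (hΩ : IsC11Domain Ω) {x₀ : Euc d} (hx₀ : x₀ ∈ closure Ω) :
    HasLocalCone Ω x₀ := by
  by_cases h : x₀ ∈ Ω
  · exact hasLocalCone_of_mem hΩ.isOpen h
  · exact hΩ.boundary.hasLocalCone (by rw [hΩ.isOpen.frontier_eq]; exact ⟨hx₀, h⟩)

theorem IsC11Domain.isFiniteMeasure (hΩ : IsC11Domain Ω) :
    IsFiniteMeasure (volume.restrict Ω) :=
  ⟨by simpa using hΩ.isBounded.measure_lt_top⟩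

theorem eLpNorm_two_sq {X E : Type*} [MeasurableSpace X] [NormedAddCommGroup E] (μ : Measure X)
    (f : X → E) : eLpNorm f 2 μ ^ 2 = ∫⁻ x, ‖f x‖ₑ ^ 2 ∂μ := by
  have := eLpNorm_nnreal_pow_eq_lintegral (f := f) (μ := μ) (p := 2) two_ne_zero
  simpa using this

/-- The mean over a set `K` of translations along which `A` stays in `Ω` is close to `u`. -/
theorem IsH1.lintegral_average_sub_sq_le [IsFiniteMeasure (volume.restrict Ω)] (hΩ : IsOpen Ω)
    {u : Euc d → ℝ} {G : Euc d → Euc d} (hu : IsH1 Ω u G) (hum : StronglyMeasurable u)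
    (hA : IsOpen A) (hKm : MeasurableSet K) (hK0 : volume K ≠ 0) (hKtop : volume K ≠ ⊤)
    (hseg : ∀ x ∈ A, ∀ z ∈ K, ∀ t ∈ Set.Icc (0 : ℝ) 1, x + t • z ∈ Ω) {m : ℝ≥0∞}
    (hm : ∀ z ∈ K, ‖z‖ₑ ≤ m) :
    ∫⁻ x in A, ‖(⨍ z in K, u (x + z)) - u x‖ₑ ^ 2 ≤
      (m * eLpNorm G 2 (volume.restrict Ω)) ^ 2 := by
  set ν : Measure (Euc d) := (volume K)⁻¹ • volume.restrict K with hν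
  have hνprob : IsProbabilityMeasure ν := ⟨by
    rw [hν, Measure.smul_apply, Measure.restrict_apply_univ, smul_eq_mul,
      ENNReal.inv_mul_cancel hK0 hKtop]⟩
  have havg : ∀ f : Euc d → ℝ, ⨍ z in K, f z = ∫ z, f z ∂ν := fun f => by
    rw [average_eq', hν, Measure.restrict_apply_univ]
  have hνK : ∀ᵐ z ∂ν, z ∈ K := by
    rw [hν]
    exact Measure.ae_smul_measure (ae_restrict_mem hKm) _
  have hAh : ∀ x ∈ A, ∀ z ∈ K, x + z ∈ Ω := fun x hx z hz => by
    simpa using hseg x hx z hz 1 (by simp)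
  have hmeas : Measurable fun p : Euc d × Euc d => ‖u (p.1 + p.2) - u p.1‖ₑ ^ 2 := by
    have := hum.measurable
    fun_prop
  -- Jensen's inequality for the normalized measure on K; Tonelli then reduces the claim to the
  -- estimate for single translations.
  have hpoint : ∀ x ∈ A, ‖(⨍ z in K, u (x + z)) - u x‖ₑ ^ 2 ≤
      ∫⁻ z, ‖u (x + z) - u x‖ₑ ^ 2 ∂ν := fun x hx => by
    have hint : Integrable (fun z => u (x + z)) ν := by
      rw [hν]
      refine Integrable.smul_measure ?_ (ENNReal.inv_ne_top.2 hK0)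
      have hmp := (measurePreserving_add_left volume x).restrict_preimage
        (s := Ω) hΩ.measurableSet
      exact ((hmp.integrable_comp hum.aestronglyMeasurable).2
        (hu.memLp.integrable one_le_two)).mono_measure
        (Measure.restrict_mono (fun z hz => hAh x hx z hz) le_rfl)
    have h1 : (⨍ z in K, u (x + z)) - u x = ∫ z, (u (x + z) - u x) ∂ν := by
      rw [integral_sub hint (integrable_const _), havg]
      simp
    rw [h1, ← eLpNorm_two_sq]
    gcongr
    refine (enorm_integral_le_lintegral_enorm _).trans ?_
    rw [← eLpNorm_one_eq_lintegral_enorm]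
    exact eLpNorm_le_eLpNorm_of_exponent_le one_le_two
      (hint.sub (integrable_const _)).aestronglyMeasurable
  calc ∫⁻ x in A, ‖(⨍ z in K, u (x + z)) - u x‖ₑ ^ 2
      ≤ ∫⁻ x in A, ∫⁻ z, ‖u (x + z) - u x‖ₑ ^ 2 ∂ν :=
        setLIntegral_mono' hA.measurableSet hpoint
    _ = ∫⁻ z, ∫⁻ x in A, ‖u (x + z) - u x‖ₑ ^ 2 ∂volume ∂ν :=
        lintegral_lintegral_swap hmeas.aemeasurable
    _ ≤ ∫⁻ _z, (m * eLpNorm G 2 (volume.restrict Ω)) ^ 2 ∂ν := by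
        refine lintegral_mono_ae ?_
        filter_upwards [hνK] with z hz
        rw [← eLpNorm_two_sq]
        gcongr
        refine (hu.eLpNorm_translate_sub_le hΩ hA z fun x hx t ht => hseg x hx z hz t ht).trans ?_
        gcongr
        exact hm z hz
    _ = _ := by simp

theorem stronglyMeasurable_average_translate {u : Euc d → ℝ} (hu : StronglyMeasurable u)
    (K : Set (Euc d)) : StronglyMeasurable fun x => ⨍ z in K, u (x + z) := by
  have h : StronglyMeasurable fun x => ∫ z in K, u (x + z) :=
    StronglyMeasurable.integral_prod_right (f := fun x z => u (x + z))
      (hu.comp_measurable (by fun_prop : Measurable fun p : Euc d × Euc d => p.1 + p.2))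
  simp only [setAverage_eq]
  exact h.const_smul (volume.real K)⁻¹

/-- For fixed x the mean is, up to a factor, the integral of u_n over x + K ⊆ Ω and tends to zero.
The L¹ bound makes the means uniformly bounded, so dominated convergence applies. -/
theorem tendsto_lintegral_average_sq [IsFiniteMeasure (volume.restrict Ω)]
    {u : ℕ → Euc d → ℝ} (hum : ∀ n, StronglyMeasurable (u n)) {R : ℝ}
    (hR : ∀ n, ∫ x in Ω, ‖u n x‖ ≤ R) (hint : ∀ n, IntegrableOn (u n) Ω)
    (hlim : ∀ B, MeasurableSet B → B ⊆ Ω → Tendsto (fun n => ∫ x in B, u n x) atTop (𝓝 0))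
    (hAΩ : A ⊆ Ω) (hA : MeasurableSet A) (hKm : MeasurableSet K)
    (hAK : ∀ x ∈ A, ∀ z ∈ K, x + z ∈ Ω) :
    Tendsto (fun n => ∫⁻ x in A, ‖⨍ z in K, u n (x + z)‖ₑ ^ 2) atTop (𝓝 0) := by
  have htrans : ∀ n x, ∫ z in K, u n (x + z) = ∫ y in (fun y => -x + y) ⁻¹' K, u n y := fun n x => by
    have hmp := (measurePreserving_add_left volume x).setIntegral_preimage_emb
      (MeasurableEquiv.addLeft x).measurableEmbedding (u n) ((fun y => -x + y) ⁻¹' K)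
    rw [← hmp]
    congr 2
    ext z
    simp
  have hsub : ∀ x ∈ A, (fun y => -x + y) ⁻¹' K ⊆ Ω := fun x hx y hy => by
    have := hAK x hx _ hy
    simpa using this
  have hmK : ∀ x : Euc d, MeasurableSet ((fun y => -x + y) ⁻¹' K) := fun x =>
    (measurable_const_add _) hKm
  have h0 : (0 : ℝ≥0∞) = ∫⁻ x in A, 0 := by simp
  rw [h0]
  refine tendsto_lintegral_of_dominated_convergence'
    (fun _ => ENNReal.ofReal ((volume.real K)⁻¹ * R) ^ 2) (fun n => ?_) (fun n => ?_) ?_ ?_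
  · exact ((stronglyMeasurable_average_translate (hum n) K).measurable.enorm.pow_const
      2).aemeasurable
  · filter_upwards [ae_restrict_mem hA] with x hx
    rw [← ofReal_norm]
    gcongr
    rw [setAverage_eq, norm_smul, htrans, norm_inv, Real.norm_of_nonneg measureReal_nonneg]
    gcongr
    refine (norm_integral_le_integral_norm _).trans (le_trans ?_ (hR n))
    exact setIntegral_mono_set (hint n).norm (Eventually.of_forall fun _ => norm_nonneg _)
      (hsub x hx).eventuallyLE
  · have : IsFiniteMeasure (volume.restrict A) :=
      isFiniteMeasure_of_le _ (Measure.restrict_mono hAΩ le_rfl)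
    rw [lintegral_const]
    finiteness
  · filter_upwards [ae_restrict_mem hA] with x hx
    have h1 := (hlim _ (hmK x) (hsub x hx)).const_mul (volume.real K)⁻¹
    simp only [setAverage_eq, htrans, smul_eq_mul]
    have h2 := ((ENNReal.continuous_pow 2).tendsto _).comp h1.enorm
    simpa [Function.comp_def] using h2

/-- Rellich's theorem: a sequence that is bounded in `H¹` and tends weakly to zero tends to zero
in `L²`. -/
theorem IsC11Domain.tendsto_lintegral_sq (hΩ : IsC11Domain Ω) {u : ℕ → Euc d → ℝ}
    {G : ℕ → Euc d → Euc d} (hu : ∀ n, IsH1 Ω (u n) (G n)) (hum : ∀ n, StronglyMeasurable (u n))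
    {R : ℝ} (hR : ∀ n, ∫ x in Ω, ‖u n x‖ ≤ R) {M : ℝ≥0}
    (hM : ∀ n, eLpNorm (G n) 2 (volume.restrict Ω) ≤ M)
    (hlim : ∀ B, MeasurableSet B → B ⊆ Ω → Tendsto (fun n => ∫ x in B, u n x) atTop (𝓝 0)) :
    Tendsto (fun n => ∫⁻ x in Ω, ‖u n x‖ₑ ^ 2) atTop (𝓝 0) := by
  have := hΩ.isFiniteMeasure
  suffices h : Tendsto (fun n => ∫⁻ x in Ω ∩ closure Ω, ‖u n x‖ₑ ^ 2) atTop (𝓝 0) by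
    rwa [Set.inter_eq_left.2 subset_closure] at h
  have hcomp : IsCompact (closure Ω) := hΩ.isBounded.isCompact_closure
  -- Compactness of the closure reduces the claim to a neighbourhood of one point, where a cone is
  -- available.
  refine hcomp.induction_on (p := fun S =>
    Tendsto (fun n => ∫⁻ x in Ω ∩ S, ‖u n x‖ₑ ^ 2) atTop (𝓝 0)) (by simp) ?_ ?_ ?_
  · intro S T hST hT
    exact tendsto_of_tendsto_of_tendsto_of_le_of_le tendsto_const_nhds hT (fun _ => zero_le)
      fun n => lintegral_mono_set (Set.inter_subset_inter_right _ hST)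
  · intro S T hS hT
    have := hS.add hT
    rw [add_zero] at this
    refine tendsto_of_tendsto_of_tendsto_of_le_of_le tendsto_const_nhds this (fun _ => zero_le)
      fun n => ?_
    rw [Set.inter_union_distrib_left]
    exact lintegral_union_le _ _ _
  · intro x₀ hx₀
    obtain ⟨r, hr, e, δ, hδ, s₀, hs₀, hcone⟩ := hΩ.hasLocalCone hx₀
    refine ⟨ball x₀ r, mem_nhdsWithin_of_mem_nhds (ball_mem_nhds _ hr), ?_⟩
    have hAo : IsOpen (Ω ∩ ball x₀ r) := hΩ.isOpen.inter isOpen_ball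
    rw [ENNReal.tendsto_nhds_zero]
    intro ε hε
    -- The size s of the averaging set is fixed before n, so that replacing u_n by its means costs
    -- less than ε/2 for every n.
    obtain ⟨s, hs, hsε⟩ : ∃ s ∈ Set.Ioc 0 s₀,
        2 * (ENNReal.ofReal (s * (‖e‖ + δ)) * M) ^ 2 < ε / 2 := by
      have ht : Tendsto (fun s : ℝ => 2 * (ENNReal.ofReal (s * (‖e‖ + δ)) * M) ^ 2) (𝓝[>] 0)
          (𝓝 (2 * (ENNReal.ofReal (0 * (‖e‖ + δ)) * M) ^ 2)) := by
        refine tendsto_nhdsWithin_of_tendsto_nhds (Continuous.tendsto ?_ 0)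
        refine (ENNReal.continuous_const_mul (by simp)).comp
          ((ENNReal.continuous_pow 2).comp ?_)
        exact (ENNReal.continuous_mul_const (by simp)).comp
          (ENNReal.continuous_ofReal.comp (by fun_prop))
      have h0 : 2 * (ENNReal.ofReal (0 * (‖e‖ + δ)) * M) ^ 2 < ε / 2 := by
        simpa using hε.ne'
      have := (ht.eventually (gt_mem_nhds h0)).and (Ioc_mem_nhdsGT hs₀)
      obtain ⟨s, hs1, hs2⟩ := this.exists
      exact ⟨s, hs2, hs1⟩
    -- The slice of the cone at height s: it has positive measure, and translations by its points
    -- keep the segment inside Ω.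
    set Ks := closedBall (s • e) (s * δ) with hKs
    have hcone' : ∀ x ∈ Ω ∩ ball x₀ r, ∀ z ∈ Ks, ∀ t ∈ Set.Icc (0 : ℝ) 1, x + t • z ∈ Ω := by
      intro x hx z hz t ht
      have hw : s⁻¹ • z ∈ closedBall e δ := by
        rw [mem_closedBall, dist_eq_norm] at hz ⊢
        have h1 : s⁻¹ • z - e = s⁻¹ • (z - s • e) := by
          rw [smul_sub, smul_smul, inv_mul_cancel₀ hs.1.ne', one_smul]
        rw [h1, norm_smul, norm_inv, Real.norm_of_nonneg hs.1.le, inv_mul_le_iff₀ hs.1]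
        exact hz
      have := hcone x hx _ hw (t * s) ⟨mul_nonneg ht.1 hs.1.le, by nlinarith [ht.1, ht.2, hs.1, hs.2]⟩
      rwa [smul_smul, mul_assoc, mul_inv_cancel₀ hs.1.ne', mul_one] at this
    have hKm : MeasurableSet Ks := isClosed_closedBall.measurableSet
    have hK0 : volume Ks ≠ 0 := (measure_closedBall_pos _ _ (mul_pos hs.1 hδ)).ne'
    have hKtop : volume Ks ≠ ⊤ := measure_closedBall_lt_top.ne
    have hKn : ∀ z ∈ Ks, ‖z‖ₑ ≤ ENNReal.ofReal (s * (‖e‖ + δ)) := fun z hz => by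
      rw [← ofReal_norm]
      refine ENNReal.ofReal_le_ofReal ?_
      rw [hKs, mem_closedBall, dist_eq_norm] at hz
      have h1 := norm_le_norm_add_norm_sub' z (s • e)
      rw [norm_smul, Real.norm_of_nonneg hs.1.le] at h1
      linarith
    have havg := tendsto_lintegral_average_sq hum hR
      (fun n => (hu n).memLp.integrable one_le_two) hlim Set.inter_subset_left hAo.measurableSet
      hKm fun x hx z hz => by simpa using hcone' x hx z hz 1 (by simp)
    have h2avg := ENNReal.Tendsto.const_mul (a := 2) havg (Or.inr (by simp))
    rw [mul_zero] at h2avg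
    have hε2 : 0 < ε / 2 := ENNReal.half_pos hε.ne'
    filter_upwards [h2avg.eventually (gt_mem_nhds hε2)] with n hn
    have hdiff := (hu n).lintegral_average_sub_sq_le hΩ.isOpen (hum n) hAo hKm hK0 hKtop hcone' hKn
    have hpt : ∀ a b : ℝ, ‖b‖ₑ ^ 2 ≤ 2 * ‖a‖ₑ ^ 2 + 2 * ‖a - b‖ₑ ^ 2 := fun a b => by
      have h1 : b ^ 2 ≤ 2 * a ^ 2 + 2 * (a - b) ^ 2 := by nlinarith [sq_nonneg (2 * a - b)]
      have e1 : ∀ c : ℝ, ‖c‖ₑ ^ 2 = ENNReal.ofReal (c ^ 2) := fun c => by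
        rw [← ofReal_norm, ← ENNReal.ofReal_pow (norm_nonneg _), Real.norm_eq_abs, sq_abs]
      rw [e1, e1, e1, ← ENNReal.ofReal_ofNat 2, ← ENNReal.ofReal_mul (by norm_num),
        ← ENNReal.ofReal_mul (by norm_num), ← ENNReal.ofReal_add (by positivity) (by positivity)]
      exact ENNReal.ofReal_le_ofReal h1
    have hmeasavg : Measurable fun x => ⨍ z in Ks, u n (x + z) :=
      (stronglyMeasurable_average_translate (hum n) Ks).measurable
    calc ∫⁻ x in Ω ∩ ball x₀ r, ‖u n x‖ₑ ^ 2
        ≤ ∫⁻ x in Ω ∩ ball x₀ r, (2 * ‖⨍ z in Ks, u n (x + z)‖ₑ ^ 2 +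
          2 * ‖(⨍ z in Ks, u n (x + z)) - u n x‖ₑ ^ 2) := lintegral_mono fun x => hpt _ _
      _ = 2 * (∫⁻ x in Ω ∩ ball x₀ r, ‖⨍ z in Ks, u n (x + z)‖ₑ ^ 2) +
          2 * ∫⁻ x in Ω ∩ ball x₀ r, ‖(⨍ z in Ks, u n (x + z)) - u n x‖ₑ ^ 2 := by
          rw [lintegral_add_left ((hmeasavg.enorm.pow_const 2).const_mul 2),
            lintegral_const_mul' _ _ (by simp), lintegral_const_mul' _ _ (by simp)]
      _ ≤ ε / 2 + ε / 2 := by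
          refine add_le_add hn.le (le_trans ?_ hsε.le)
          gcongr
          refine hdiff.trans ?_
          gcongr
          exact hM n
      _ = ε := ENNReal.add_halves ε

end Rellich

/-! ### Comparison of weighted measures with Lebesgue measure. -/

section Weights

variable {d : ℕ} {Ω : Set (Euc d)} {σ : Euc d → ℝ}

/-- A measurable weight on `Ω` that is bounded above and below by positive constants. -/
structure IsWeight (Ω : Set (Euc d)) (σ : Euc d → ℝ) : Prop where
  measurableSet : MeasurableSet Ω
  aemeasurable : AEMeasurable σ (volume.restrict Ω)
  bounds : ∃ a b : ℝ, 0 < a ∧ 0 < b ∧ ∀ x ∈ Ω, a ≤ σ x ∧ σ x ≤ b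

theorem IsWeight.pos (hσ : IsWeight Ω σ) {x : Euc d} (hx : x ∈ Ω) : 0 < σ x := by
  obtain ⟨a, b, ha, -, h⟩ := hσ.bounds
  exact ha.trans_le (h x hx).1

theorem IsSmoothDensity.isWeight {ρ : Euc d → ℝ} (hΩ : IsC11Domain Ω)
    (hρ : IsSmoothDensity Ω ρ) : IsWeight Ω ρ := by
  refine ⟨hΩ.isOpen.measurableSet,
    hρ.smooth.continuousOn.aemeasurable hΩ.isOpen.measurableSet, ?_⟩
  obtain ⟨a, b, ha, h⟩ := hρ.bounds
  obtain ⟨x, hx⟩ := hΩ.isConnected.nonempty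
  exact ⟨a, b, ha, ha.trans_le ((h x hx).1.trans (h x hx).2), h⟩

theorem IsWeight.sq (hσ : IsWeight Ω σ) : IsWeight Ω fun x => σ x ^ 2 := by
  refine ⟨hσ.measurableSet, hσ.aemeasurable.pow_const 2, ?_⟩
  obtain ⟨a, b, ha, hb, h⟩ := hσ.bounds
  refine ⟨a ^ 2, b ^ 2, by positivity, by positivity, fun x hx => ⟨?_, ?_⟩⟩
  · have := (h x hx).1
    gcongr
  · have := (h x hx).1
    exact pow_le_pow_left₀ (by linarith) (h x hx).2 2

/-- For bounds a ≤ σ ≤ b the constant max(b, 1/a) serves in both directions. Null sets and L²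
membership therefore do not depend on the weight. -/
theorem IsWeight.exists_measure_le (hσ : IsWeight Ω σ) : ∃ c : ℝ≥0, c ≠ 0 ∧
    dataMeasure Ω σ ≤ (c : ℝ≥0∞) • volume.restrict Ω ∧
    volume.restrict Ω ≤ (c : ℝ≥0∞) • dataMeasure Ω σ := by
  obtain ⟨a, b, ha, hb, h⟩ := hσ.bounds
  have hae := ae_restrict_mem (μ := (volume : Measure (Euc d))) hσ.measurableSet
  have h1 : dataMeasure Ω σ ≤ ENNReal.ofReal b • volume.restrict Ω := by
    rw [← withDensity_const]
    refine withDensity_mono ?_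
    filter_upwards [hae] with x hx
    exact ENNReal.ofReal_le_ofReal (h x hx).2
  have h2 : ENNReal.ofReal a • volume.restrict Ω ≤ dataMeasure Ω σ := by
    rw [← withDensity_const]
    refine withDensity_mono ?_
    filter_upwards [hae] with x hx
    exact ENNReal.ofReal_le_ofReal (h x hx).1
  have hmono : ∀ {c c' : ℝ} (ν : Measure (Euc d)), c ≤ c' →
      ENNReal.ofReal c • ν ≤ ENNReal.ofReal c' • ν := fun {c c'} ν hc => by
    refine Measure.le_iff'.2 fun s => ?_
    simp only [Measure.smul_apply, smul_eq_mul]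
    gcongr
  refine ⟨(max b a⁻¹).toNNReal, ?_, h1.trans (hmono _ (le_max_left _ _)),
    le_trans ?_ (hmono _ (le_max_right b a⁻¹))⟩
  · exact (Real.toNNReal_pos.2 (lt_max_of_lt_left hb)).ne'
  · refine Measure.le_iff'.2 fun s => ?_
    have h3 := Measure.le_iff'.1 h2 s
    simp only [Measure.smul_apply, smul_eq_mul] at h3 ⊢
    calc (volume.restrict Ω) s = ENNReal.ofReal a⁻¹ * (ENNReal.ofReal a * (volume.restrict Ω) s) := by
          rw [← mul_assoc, ← ENNReal.ofReal_mul (by positivity), inv_mul_cancel₀ ha.ne',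
            ENNReal.ofReal_one, one_mul]
      _ ≤ _ := by gcongr

theorem IsWeight.memLp_iff {E : Type*} [NormedAddCommGroup E] (hσ : IsWeight Ω σ) {p : ℝ≥0∞}
    {f : Euc d → E} : MemLp f p (dataMeasure Ω σ) ↔ MemLp f p (volume.restrict Ω) := by
  obtain ⟨c, -, h1, h2⟩ := hσ.exists_measure_le
  exact ⟨fun h => h.of_measure_le_smul (by simp) h2, fun h => h.of_measure_le_smul (by simp) h1⟩

theorem IsWeight.ae_eq (hσ : IsWeight Ω σ) : ae (dataMeasure Ω σ) = ae (volume.restrict Ω) := by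
  obtain ⟨c, -, h1, h2⟩ := hσ.exists_measure_le
  exact le_antisymm (Measure.absolutelyContinuous_of_le_smul h1).ae_le
    (Measure.absolutelyContinuous_of_le_smul h2).ae_le

theorem IsWeight.integral_eq {E : Type*} [NormedAddCommGroup E] [NormedSpace ℝ E]
    (hσ : IsWeight Ω σ) (f : Euc d → E) :
    ∫ x, f x ∂(dataMeasure Ω σ) = ∫ x in Ω, σ x • f x := by
  rw [dataMeasure, integral_withDensity_eq_integral_toReal_smul₀ hσ.aemeasurable.ennreal_ofReal
    (Filter.Eventually.of_forall fun _ => ENNReal.ofReal_lt_top)]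
  refine setIntegral_congr_fun hσ.measurableSet fun x hx => ?_
  rw [ENNReal.toReal_ofReal (hσ.pos hx).le]

theorem IsWeight.isFiniteMeasure [IsFiniteMeasure (volume.restrict Ω)] (hσ : IsWeight Ω σ) :
    IsFiniteMeasure (dataMeasure Ω σ) := by
  obtain ⟨c, -, h1, -⟩ := hσ.exists_measure_le
  have : IsFiniteMeasure ((c : ℝ≥0∞) • volume.restrict Ω) :=
    Measure.smul_finite _ (by simp)
  exact isFiniteMeasure_of_le _ h1

end Weights

/-! ### H¹(Ω) as a closed subspace of a product of L² spaces. -/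

section SobolevSpace

variable {d : ℕ} {Ω : Set (Euc d)} {ρ : Euc d → ℝ}

theorem IsH1.congr {u u' : Euc d → ℝ} {G G' : Euc d → Euc d} (h : IsH1 Ω u G)
    (hu : u =ᵐ[volume.restrict Ω] u') (hG : G =ᵐ[volume.restrict Ω] G') : IsH1 Ω u' G' := by
  refine ⟨(memLp_congr_ae hu).1 h.memLp, (memLp_congr_ae hG).1 h.memLp_grad, fun φ h1 h2 h3 => ?_⟩
  have h4 := h.weak_grad φ h1 h2 h3
  have e1 : ∫ x in Ω, u' x • gradient φ x = ∫ x in Ω, u x • gradient φ x :=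
    integral_congr_ae (by filter_upwards [hu] with x hx; rw [hx])
  have e2 : ∫ x in Ω, φ x • G' x = ∫ x in Ω, φ x • G x :=
    integral_congr_ae (by filter_upwards [hG] with x hx; rw [hx])
  rw [e1, e2, h4]

theorem isH1_of_forall_integral_fderiv {u : Euc d → ℝ} {G : Euc d → Euc d}
    (hu : MemLp u 2 (volume.restrict Ω)) (hG : MemLp G 2 (volume.restrict Ω))
    (hw : ∀ φ, IsTest Ω φ → ∀ h : Euc d,
      ∫ x in Ω, u x * fderiv ℝ φ x h = -∫ x in Ω, φ x * inner ℝ (G x) h) : IsH1 Ω u G := by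
  refine ⟨hu, hG, fun φ h1 h2 h3 => ?_⟩
  have hul : LocallyIntegrable u (volume.restrict Ω) := hu.locallyIntegrable one_le_two
  have hGl : LocallyIntegrable G (volume.restrict Ω) := hG.locallyIntegrable one_le_two
  have hgc : Continuous (gradient φ) :=
    (LinearIsometryEquiv.continuous _).comp (h1.continuous_fderiv (by simp))
  have hgs : HasCompactSupport (gradient φ) := (h2.fderiv (𝕜 := ℝ)).comp_left (map_zero _)
  refine ext_inner_left ℝ fun h => ?_
  rw [inner_neg_right, ← integral_inner
    (hGl.integrable_smul_left_of_hasCompactSupport h1.continuous h2),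
    ← integral_inner (hul.integrable_smul_right_of_hasCompactSupport hgc hgs)]
  have e1 : ∀ x, inner ℝ h (u x • gradient φ x) = u x * fderiv ℝ φ x h := fun x => by
    rw [inner_smul_right, real_inner_comm, gradient, InnerProductSpace.toDual_symm_apply]
  have e2 : ∀ x, inner ℝ h (φ x • G x) = φ x * inner ℝ (G x) h := fun x => by
    rw [inner_smul_right, real_inner_comm]
  simpa only [e1, e2] using hw φ ⟨h1, h2, h3⟩ h

/-- Test functions belong to `H¹`. -/
theorem IsTest.isH1 [IsFiniteMeasure (volume.restrict Ω)] {φ : Euc d → ℝ} (hφ : IsTest Ω φ) :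
    IsH1 Ω φ (gradient φ) := by
  have hgc : Continuous (gradient φ) :=
    (LinearIsometryEquiv.continuous _).comp (hφ.1.continuous_fderiv (by simp))
  have hgs : HasCompactSupport (gradient φ) := (hφ.2.fderiv (𝕜 := ℝ)).comp_left (map_zero _)
  refine isH1_of_forall_integral_fderiv (hφ.memLp 2 _)
    (hgc.memLp_of_hasCompactSupport hgs) fun ψ hψ h => ?_
  have hψ0 : ∀ x, x ∉ Ω → ψ x = 0 := fun x hx =>
    image_eq_zero_of_notMem_tsupport fun hx' => hx (hψ.3 hx')
  have hφ0 : ∀ x, x ∉ Ω → φ x = 0 := fun x hx =>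
    image_eq_zero_of_notMem_tsupport fun hx' => hx (hφ.3 hx')
  have hc1 : Continuous fun x => fderiv ℝ φ x h :=
    (hφ.1.continuous_fderiv (by simp)).clm_apply continuous_const
  have hc2 : Continuous fun x => fderiv ℝ ψ x h :=
    (hψ.1.continuous_fderiv (by simp)).clm_apply continuous_const
  have key := integral_mul_fderiv_eq_neg_fderiv_mul_of_integrable (μ := volume) (f := φ) (g := ψ)
    (v := h)
    ((hc1.mul hψ.1.continuous).integrable_of_hasCompactSupport hψ.2.mul_left)
    ((hφ.1.continuous.mul hc2).integrable_of_hasCompactSupport hφ.2.mul_right)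
    ((hφ.1.continuous.mul hψ.1.continuous).integrable_of_hasCompactSupport hφ.2.mul_right)
    (fun x _ => hφ.1.differentiable (by simp) x) (fun x _ => hψ.1.differentiable (by simp) x)
  rw [setIntegral_eq_integral_of_forall_compl_eq_zero,
    setIntegral_eq_integral_of_forall_compl_eq_zero, key]
  · congr 1
    refine integral_congr_ae (Filter.Eventually.of_forall fun x => ?_)
    simp only
    rw [gradient, InnerProductSpace.toDual_symm_apply, mul_comm]
  · intro x hx
    rw [hψ0 x hx, zero_mul]
  · intro x hx
    rw [hφ0 x hx, zero_mul]

/-- Pairs of a function in `L²_μ` and a vector field that is square integrable with respect to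
`ρ² dx`. -/
abbrev PairSpace (Ω : Set (Euc d)) (ρ : Euc d → ℝ) : Type :=
  WithLp 2 (L2 Ω ρ × Lp (Euc d) 2 (dataMeasure Ω fun x => ρ x ^ 2))

/-- The pairs that are orthogonal to all weak gradients, in the form given by test functions. -/
def testPairs (Ω : Set (Euc d)) (ρ : Euc d → ℝ) : Set (PairSpace Ω ρ) :=
  {q | ∃ φ, IsTest Ω φ ∧ ∃ h : Euc d, q.fst =ᵐ[volume.restrict Ω] (fun x => fderiv ℝ φ x h / ρ x) ∧
    q.snd =ᵐ[volume.restrict Ω] fun x => (φ x / ρ x ^ 2) • h}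

/-- The space `H¹(Ω)`, as a closed space of pairs of a function and its weak gradient, with the
inner product `∫ u v ρ + ∫ ρ² ∇u · ∇v`. -/
noncomputable def sobolevPairs (Ω : Set (Euc d)) (ρ : Euc d → ℝ) : Submodule ℝ (PairSpace Ω ρ) :=
  (Submodule.span ℝ (testPairs Ω ρ))ᗮ

theorem IsWeight.integral_mul_eq_inner (hρ : IsWeight Ω ρ) (u v : L2 Ω ρ) :
    inner ℝ u v = ∫ x in Ω, ρ x * (u x * v x) := by
  rw [L2.inner_def, hρ.integral_eq]
  refine integral_congr_ae (Filter.Eventually.of_forall fun x => ?_)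
  simp [mul_comm]

theorem IsWeight.integral_inner_eq_inner (hρ : IsWeight Ω ρ)
    (u v : Lp (Euc d) 2 (dataMeasure Ω fun x => ρ x ^ 2)) :
    inner ℝ u v = ∫ x in Ω, ρ x ^ 2 * inner ℝ (u x) (v x) := by
  rw [L2.inner_def, hρ.sq.integral_eq]
  rfl

theorem memLp_mul_inv (hρ : IsWeight Ω ρ) [IsFiniteMeasure (volume.restrict Ω)]
    {E : Type*} [NormedAddCommGroup E] [NormedSpace ℝ E] {f : Euc d → E}
    (hf : MemLp f 2 (volume.restrict Ω)) : MemLp (fun x => (ρ x)⁻¹ • f x) 2 (volume.restrict Ω) := by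
  obtain ⟨a, b, ha, -, h⟩ := hρ.bounds
  refine MemLp.of_le_mul (c := a⁻¹) hf (hρ.aemeasurable.inv.aestronglyMeasurable.smul hf.1) ?_
  filter_upwards [ae_restrict_mem hρ.measurableSet] with x hx
  rw [norm_smul, norm_inv, Real.norm_of_nonneg (hρ.pos hx).le]
  gcongr
  exact (h x hx).1

/-- The factors 1/ρ and 1/ρ² in the test pairs cancel the densities of the two inner products, so
orthogonality to a test pair is the weak gradient identity in one direction h. Completeness of H¹
then comes from its being an orthogonal complement. -/
theorem mem_sobolevPairs_iff [IsFiniteMeasure (volume.restrict Ω)] (hρ : IsWeight Ω ρ)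
    (p : PairSpace Ω ρ) : p ∈ sobolevPairs Ω ρ ↔ IsH1 Ω p.fst p.snd := by
  have hinner : ∀ φ, IsTest Ω φ → ∀ (h : Euc d) (q : PairSpace Ω ρ),
      q.fst =ᵐ[volume.restrict Ω] (fun x => fderiv ℝ φ x h / ρ x) →
      q.snd =ᵐ[volume.restrict Ω] (fun x => (φ x / ρ x ^ 2) • h) →
      inner ℝ q p = (∫ x in Ω, p.fst x * fderiv ℝ φ x h) + ∫ x in Ω, φ x * inner ℝ (p.snd x) h := by
    intro φ hφ h q hq1 hq2
    rw [WithLp.prod_inner_apply, hρ.integral_mul_eq_inner, hρ.integral_inner_eq_inner]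
    congr 1
    · refine integral_congr_ae ?_
      filter_upwards [hq1, ae_restrict_mem hρ.measurableSet] with x hx hxΩ
      have := (hρ.pos hxΩ).ne'
      change ρ x * (q.fst x * p.fst x) = _
      rw [hx]
      field_simp
    · refine integral_congr_ae ?_
      filter_upwards [hq2, ae_restrict_mem hρ.measurableSet] with x hx hxΩ
      have := (hρ.pos hxΩ).ne'
      change ρ x ^ 2 * (inner ℝ (q.snd x) (p.snd x)) = _
      rw [hx, real_inner_smul_left, real_inner_comm]
      field_simp
  have hp1 : MemLp p.fst 2 (volume.restrict Ω) := hρ.memLp_iff.1 (Lp.memLp p.fst)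
  have hp2 : MemLp p.snd 2 (volume.restrict Ω) := hρ.sq.memLp_iff.1 (Lp.memLp p.snd)
  have hmem : p ∈ sobolevPairs Ω ρ ↔ ∀ q ∈ testPairs Ω ρ, inner ℝ q p = 0 := by
    constructor
    · intro h q hq
      exact (Submodule.mem_orthogonal _ _).1 h q (Submodule.subset_span hq)
    · intro h
      refine (Submodule.mem_orthogonal _ _).2 fun q hq => ?_
      refine Submodule.span_induction h (by simp) (fun x y _ _ hx hy => ?_)
        (fun c x _ hx => ?_) hq
      · rw [inner_add_left, hx, hy, add_zero]
      · rw [inner_smul_left, hx, mul_zero]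
  rw [hmem]
  constructor
  · intro h
    refine isH1_of_forall_integral_fderiv hp1 hp2 fun φ hφ v => ?_
    have hc2 : Continuous fun x => fderiv ℝ φ x v :=
      (hφ.1.continuous_fderiv (by simp)).clm_apply continuous_const
    have hm1 : MemLp (fun x => fderiv ℝ φ x v / ρ x) 2 (volume.restrict Ω) := by
      have := memLp_mul_inv hρ (f := fun x => fderiv ℝ φ x v)
        (hc2.memLp_of_hasCompactSupport (hφ.2.fderiv_apply (𝕜 := ℝ) v))
      simpa only [div_eq_inv_mul, smul_eq_mul] using this
    have hm2 : MemLp (fun x => (φ x / ρ x ^ 2) • v) 2 (volume.restrict Ω) := by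
      have := memLp_mul_inv hρ.sq (f := fun x => φ x • v)
        ((hφ.1.continuous.smul continuous_const).memLp_of_hasCompactSupport hφ.2.smul_right)
      simpa only [div_eq_inv_mul, mul_smul] using this
    let q : PairSpace Ω ρ := WithLp.toLp 2
      ((hρ.memLp_iff.2 hm1).toLp _, (hρ.sq.memLp_iff.2 hm2).toLp _)
    have hq1 : q.fst =ᵐ[volume.restrict Ω] (fun x => fderiv ℝ φ x v / ρ x) := by
      rw [← hρ.ae_eq]
      exact MemLp.coeFn_toLp (hρ.memLp_iff.2 hm1)
    have hq2 : q.snd =ᵐ[volume.restrict Ω] (fun x => (φ x / ρ x ^ 2) • v) := by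
      rw [← hρ.sq.ae_eq]
      exact MemLp.coeFn_toLp (hρ.sq.memLp_iff.2 hm2)
    have h1 := h q ⟨φ, hφ, v, hq1, hq2⟩
    rw [hinner φ hφ v q hq1 hq2] at h1
    linarith
  · rintro h q ⟨φ, hφ, v, hq1, hq2⟩
    rw [hinner φ hφ v q hq1 hq2, h.integral_fderiv hφ v, neg_add_cancel]

/-- The element of the Sobolev space given by a function with its weak gradient. -/
theorem IsH1.exists_mem_sobolevPairs [IsFiniteMeasure (volume.restrict Ω)] (hρ : IsWeight Ω ρ)
    {v : Euc d → ℝ} {H : Euc d → Euc d} (h : IsH1 Ω v H) :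
    ∃ q : sobolevPairs Ω ρ, (q : PairSpace Ω ρ).fst =ᵐ[volume.restrict Ω] v ∧
      (q : PairSpace Ω ρ).snd =ᵐ[volume.restrict Ω] H := by
  let q : PairSpace Ω ρ := WithLp.toLp 2
    ((hρ.memLp_iff.2 h.memLp).toLp _, (hρ.sq.memLp_iff.2 h.memLp_grad).toLp _)
  have hq1 : q.fst =ᵐ[volume.restrict Ω] v := by
    rw [← hρ.ae_eq]
    exact MemLp.coeFn_toLp (hρ.memLp_iff.2 h.memLp)
  have hq2 : q.snd =ᵐ[volume.restrict Ω] H := by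
    rw [← hρ.sq.ae_eq]
    exact MemLp.coeFn_toLp (hρ.sq.memLp_iff.2 h.memLp_grad)
  exact ⟨⟨q, (mem_sobolevPairs_iff hρ q).2 (h.congr hq1.symm hq2.symm)⟩, hq1, hq2⟩

/-- The embedding of `H¹(Ω)` into `L²_μ`. -/
noncomputable def sobolevEmbedding (Ω : Set (Euc d)) (ρ : Euc d → ℝ) :
    sobolevPairs Ω ρ →L[ℝ] L2 Ω ρ :=
  (WithLp.fstL 2 ℝ (L2 Ω ρ) (Lp (Euc d) 2 (dataMeasure Ω fun x => ρ x ^ 2))).comp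
    (sobolevPairs Ω ρ).subtypeL

theorem sobolevEmbedding_apply (p : sobolevPairs Ω ρ) :
    sobolevEmbedding Ω ρ p = (p : PairSpace Ω ρ).fst := rfl

instance : CompleteSpace (sobolevPairs Ω ρ) :=
  (Submodule.isClosed_orthogonal _).completeSpace_coe

end SobolevSpace

/-! ### Compactness of the Sobolev embedding and existence of the eigenbasis. -/

section Spectrum

open Filter

variable {d : ℕ} {Ω : Set (Euc d)} {ρ σ : Euc d → ℝ}

theorem IsWeight.exists_eLpNorm_le (hσ : IsWeight Ω σ) (E : Type*) [NormedAddCommGroup E] :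
    ∃ C : ℝ≥0, ∀ f : Euc d → E, eLpNorm f 2 (dataMeasure Ω σ) ≤ C * eLpNorm f 2 (volume.restrict Ω) ∧
      eLpNorm f 2 (volume.restrict Ω) ≤ C * eLpNorm f 2 (dataMeasure Ω σ) := by
  obtain ⟨c, -, h1, h2⟩ := hσ.exists_measure_le
  refine ⟨c ^ (1 / 2 : ℝ), fun f => ?_⟩
  have e : ((c ^ (1 / 2 : ℝ) : ℝ≥0) : ℝ≥0∞) = (c : ℝ≥0∞) ^ (1 / (2 : ℝ≥0∞)).toReal := by
    rw [ENNReal.coe_rpow_of_nonneg _ (by norm_num)]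
    simp
  rw [e]
  exact ⟨by simpa using eLpNorm_le_of_measure_le_smul h1 (f := f) (p := 2),
    by simpa using eLpNorm_le_of_measure_le_smul h2 (f := f) (p := 2)⟩

theorem isCompactOperator_sobolevEmbedding (hΩ : IsC11Domain Ω) (hρ : IsWeight Ω ρ) :
    IsCompactOperator (sobolevEmbedding Ω ρ) := by
  have := hΩ.isFiniteMeasure
  have := hρ.isFiniteMeasure
  have := hρ.sq.isFiniteMeasure
  have : Fact ((2 : ℝ≥0∞) ≠ ⊤) := ⟨by simp⟩
  have : SecondCountableTopology (L2 Ω ρ) := inferInstance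
  have : SecondCountableTopology (Lp (Euc d) 2 (dataMeasure Ω fun x => ρ x ^ 2)) := inferInstance
  have : SecondCountableTopology (PairSpace Ω ρ) := inferInstance
  have : SecondCountableTopology (sobolevPairs Ω ρ) :=
    TopologicalSpace.Subtype.secondCountableTopology _
  refine isCompactOperator_of_tendsto_zero_of_weakly _ fun x ⟨R, hR⟩ hw => ?_
  obtain ⟨C, hC⟩ := hρ.exists_eLpNorm_le ℝ
  obtain ⟨C', hC'⟩ := hρ.sq.exists_eLpNorm_le (Euc d)
  have hR0 : 0 ≤ R := (norm_nonneg _).trans (hR 0)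
  have hH1 : ∀ n, IsH1 Ω (x n : PairSpace Ω ρ).fst (x n : PairSpace Ω ρ).snd := fun n =>
    (mem_sobolevPairs_iff hρ _).1 (x n).2
  have hfst : ∀ n, ‖(x n : PairSpace Ω ρ).fst‖ ≤ R := fun n =>
    (WithLp.norm_fst_le _ _).trans (hR n)
  have hsnd : ∀ n, ‖(x n : PairSpace Ω ρ).snd‖ ≤ R := fun n =>
    (WithLp.norm_snd_le _ _).trans (hR n)
  have hu : ∀ n, eLpNorm (x n : PairSpace Ω ρ).fst 2 (volume.restrict Ω) ≤ C * ENNReal.ofReal R :=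
    fun n => ((hC _).2).trans (by
      gcongr
      rw [← Lp.enorm_def, ← ofReal_norm]
      exact ENNReal.ofReal_le_ofReal (hfst n))
  have key := hΩ.tendsto_lintegral_sq hH1 (fun n => Lp.stronglyMeasurable _)
    (R := (C * ENNReal.ofReal R).toReal *
      (eLpNorm (fun _ : Euc d => (1 : ℝ)) 2 (volume.restrict Ω)).toReal)
    (M := C' * R.toNNReal) ?_ ?_ ?_
  · have h0 : Tendsto (fun n => eLpNorm (x n : PairSpace Ω ρ).fst 2 (volume.restrict Ω)) atTop
        (𝓝 0) := by
      have h1 := (ENNReal.continuous_rpow_const (y := 1 / 2)).tendsto _ |>.comp key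
      rw [ENNReal.zero_rpow_of_pos (by norm_num)] at h1
      refine h1.congr fun n => ?_
      rw [Function.comp_apply, ← eLpNorm_two_sq, ← ENNReal.rpow_natCast, ← ENNReal.rpow_mul]
      norm_num
    rw [tendsto_zero_iff_norm_tendsto_zero]
    have h2 : Tendsto (fun n => C * eLpNorm (x n : PairSpace Ω ρ).fst 2 (volume.restrict Ω)) atTop
        (𝓝 (C * 0)) := ENNReal.Tendsto.const_mul h0 (Or.inr (by simp))
    rw [mul_zero] at h2
    have h3 : Tendsto (fun n => eLpNorm (x n : PairSpace Ω ρ).fst 2 (dataMeasure Ω ρ)) atTop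
        (𝓝 0) := tendsto_of_tendsto_of_tendsto_of_le_of_le tendsto_const_nhds h2
          (fun _ => zero_le) fun n => (hC _).1
    have h4 := (ENNReal.tendsto_toReal ENNReal.zero_ne_top).comp h3
    simpa [Lp.norm_def, sobolevEmbedding_apply, Function.comp_def] using h4
  · intro n
    have h1 := integral_norm_mul_norm_le (hH1 n).memLp
      (memLp_const (μ := volume.restrict Ω) (p := 2) (1 : ℝ))
    simp only [norm_one, mul_one] at h1
    refine h1.trans ?_
    gcongr
    · finiteness
    · exact hu n
  · intro n
    refine ((hC' _).2).trans ?_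
    rw [ENNReal.coe_mul]
    gcongr
    rw [← Lp.enorm_def, ← ofReal_norm]
    exact ENNReal.ofReal_le_ofReal (hsnd n)
  · intro B hB hBΩ
    have hm : MemLp (fun x => (ρ x)⁻¹ • B.indicator (fun _ => (1 : ℝ)) x) 2 (volume.restrict Ω) :=
      memLp_mul_inv hρ ((memLp_const (1 : ℝ)).indicator hB)
    set g : L2 Ω ρ := (hρ.memLp_iff.2 hm).toLp _ with hg
    have h1 := hw ((sobolevEmbedding Ω ρ).adjoint g)
    -- Pairing with J* g, where g = 1_B / ρ, gives exactly the unweighted integral over B; this is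
    -- how weak convergence in H¹ supplies the hypothesis of Rellich's theorem.
    refine h1.congr fun n => ?_
    rw [ContinuousLinearMap.adjoint_inner_right, sobolevEmbedding_apply,
      hρ.integral_mul_eq_inner]
    have h2 : g =ᵐ[volume.restrict Ω]
        fun x => (ρ x)⁻¹ • B.indicator (fun _ => (1 : ℝ)) x := by
      rw [← hρ.ae_eq]
      exact MemLp.coeFn_toLp (hρ.memLp_iff.2 hm)
    have h3 : ∫ y in B, (x n : PairSpace Ω ρ).fst y =
        ∫ y in Ω, B.indicator (fun y => (x n : PairSpace Ω ρ).fst y) y := by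
      rw [setIntegral_indicator hB, Set.inter_eq_right.2 hBΩ]
    rw [h3]
    refine integral_congr_ae ?_
    filter_upwards [h2, ae_restrict_mem hρ.measurableSet] with y hy hyΩ
    have h4 := (hρ.pos hyΩ).ne'
    rw [hy]
    by_cases hyB : y ∈ B
    · simp only [Set.indicator_of_mem hyB, smul_eq_mul]
      field_simp
    · simp [Set.indicator_of_notMem hyB]

/-- The kernel of J* is orthogonal to the range of J, which contains the dense set of test
functions. -/
theorem eq_zero_of_adjoint_sobolevEmbedding [IsFiniteMeasure (volume.restrict Ω)]
    (hΩ : IsOpen Ω) (hρ : IsWeight Ω ρ) {f : L2 Ω ρ}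
    (hf : (sobolevEmbedding Ω ρ).adjoint f = 0) : f = 0 := by
  have := hρ.isFiniteMeasure
  have hd := testSubmodule_topologicalClosure hΩ (dataMeasure Ω ρ) (by
    rw [hρ.ae_eq]
    exact ae_restrict_mem hΩ.measurableSet)
  rw [Submodule.topologicalClosure_eq_top_iff] at hd
  have hmem : f ∈ (testSubmodule Ω (dataMeasure Ω ρ))ᗮ := by
    refine (Submodule.mem_orthogonal _ _).2 fun g ⟨φ, hφ, hg⟩ => ?_
    obtain ⟨q, hq, -⟩ := hφ.isH1.exists_mem_sobolevPairs hρ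
    have hgq : g = sobolevEmbedding Ω ρ q := by
      refine Lp.ext (hg.trans ?_)
      rw [hρ.ae_eq]
      exact hq.symm
    rw [hgq, ← ContinuousLinearMap.adjoint_inner_right, hf, inner_zero_right]
  rw [hd] at hmem
  exact hmem

/-- Ω contains infinitely many disjoint nonempty open sets, and their indicators are orthogonal and
nonzero. For d = 0 this fails, as Ω is a single point. -/
theorem not_finiteDimensional_L2 [IsFiniteMeasure (volume.restrict Ω)] (hΩ : IsOpen Ω)
    (hne : Ω.Nonempty) (hd : d ≠ 0) (hρ : IsWeight Ω ρ) : ¬ FiniteDimensional ℝ (L2 Ω ρ) := by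
  have := hρ.isFiniteMeasure
  have : NeZero d := ⟨hd⟩
  have hinf : Infinite Ω := by
    rw [Set.infinite_coe_iff]
    intro hfin
    have := hfin.measure_zero (volume : Measure (Euc d))
    exact (hΩ.measure_pos volume hne).ne' this
  obtain ⟨U, hU, hUo, hUd⟩ := exists_seq_infinite_isOpen_pairwise_disjoint Ω
  let B : ℕ → Set (Euc d) := fun n => Subtype.val '' U n
  have hBo : ∀ n, IsOpen (B n) := fun n => hΩ.isOpenMap_subtype_val _ (hUo n)
  have hBΩ : ∀ n, B n ⊆ Ω := fun n => by
    rintro _ ⟨x, -, rfl⟩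
    exact x.2
  have hBd : ∀ m n, m ≠ n → Disjoint (B m) (B n) := fun m n hmn =>
    (Set.disjoint_image_iff Subtype.val_injective).2 (hUd hmn)
  have hBpos : ∀ n, dataMeasure Ω ρ (B n) ≠ 0 := fun n h0 => by
    have h1 : volume.restrict Ω (B n) = 0 := by
      rw [measure_eq_zero_iff_ae_notMem] at h0 ⊢
      rwa [hρ.ae_eq] at h0
    rw [Measure.restrict_apply (hBo n).measurableSet, Set.inter_eq_left.2 (hBΩ n)] at h1
    exact ((hBo n).measure_pos volume ((hU n).nonempty.image _)).ne' h1
  intro hfd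
  let v : ℕ → L2 Ω ρ := fun n =>
    indicatorConstLp 2 (hBo n).measurableSet (measure_ne_top _ _) (1 : ℝ)
  have hinner : ∀ m n, inner ℝ (v m) (v n) = (dataMeasure Ω ρ).real (B m ∩ B n) := fun m n => by
    rw [L2.real_inner_indicatorConstLp_one_indicatorConstLp_one]
  have hli : LinearIndependent ℝ v := by
    refine linearIndependent_of_ne_zero_of_inner_eq_zero (𝕜 := ℝ) (fun n h0 => ?_)
      fun m n hmn => ?_
    · have h1 := hinner n n
      rw [h0, inner_zero_left, Set.inter_self, eq_comm, measureReal_eq_zero_iff] at h1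
      exact hBpos n h1
    · change inner ℝ (v m) (v n) = 0
      rw [hinner, (hBd m n hmn).inter_eq, measureReal_empty]
  have hfin := hli.finite
  exact not_finite ℕ

/-- `L²_μ` has an orthonormal basis of Neumann eigenfunctions. -/
theorem exists_isEigensystem (hΩ : IsC11Domain Ω) (hd : d ≠ 0) (hρ : IsWeight Ω ρ) :
    ∃ (lam : ℕ → ℝ) (φ : HilbertBasis ℕ ℝ (L2 Ω ρ)), IsEigensystem Ω ρ lam φ := by
  have := hΩ.isFiniteMeasure
  have := hρ.isFiniteMeasure
  obtain ⟨b, m, hanti, hm, hb⟩ := exists_hilbertBasis_comp_adjoint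
    (not_finiteDimensional_L2 hΩ.isOpen hΩ.isConnected.nonempty hd hρ) (sobolevEmbedding Ω ρ)
    (isCompactOperator_sobolevEmbedding hΩ hρ)
    fun f hf => eq_zero_of_adjoint_sobolevEmbedding hΩ.isOpen hρ hf
  -- The H¹ inner product contains the L²_μ one besides the Dirichlet form; removing it shifts 1/m_k
  -- by 1.
  refine ⟨fun k => (m k)⁻¹ - 1, b, fun i j hij => ?_, fun k => ?_⟩
  · have := inv_anti₀ (hm j) (hanti hij)
    linarith
  · obtain ⟨p, hpfst, hpinner⟩ := hb k
    rw [sobolevEmbedding_apply] at hpfst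
    refine ⟨(p : PairSpace Ω ρ).snd, ?_, fun v H hv => ?_⟩
    · rw [← hpfst]
      exact (mem_sobolevPairs_iff hρ _).1 p.2
    · obtain ⟨q, hq1, hq2⟩ := hv.exists_mem_sobolevPairs hρ
      have h1 := hpinner q
      have h2 : inner ℝ p q = inner ℝ (b k) (sobolevEmbedding Ω ρ q) +
          inner ℝ (p : PairSpace Ω ρ).snd (q : PairSpace Ω ρ).snd := by
        change inner ℝ (p : PairSpace Ω ρ) (q : PairSpace Ω ρ) = _
        rw [WithLp.prod_inner_apply, ← hpfst]
        rfl
      have h3 : inner ℝ (p : PairSpace Ω ρ).snd (q : PairSpace Ω ρ).snd =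
          ∫ x in Ω, ρ x ^ 2 * inner ℝ ((p : PairSpace Ω ρ).snd x) (H x) := by
        rw [hρ.integral_inner_eq_inner]
        refine integral_congr_ae ?_
        filter_upwards [hq2] with x hx
        rw [hx]
      have h4 : ((m k)⁻¹ - 1) * inner ℝ (b k) (sobolevEmbedding Ω ρ q) =
          ∫ x in Ω, (((m k)⁻¹ - 1) • b k : L2 Ω ρ) x * v x * ρ x := by
        rw [hρ.integral_mul_eq_inner, ← integral_const_mul]
        refine integral_congr_ae ?_
        have h5 := Lp.coeFn_smul ((m k)⁻¹ - 1) (b k)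
        rw [Filter.EventuallyEq, hρ.ae_eq] at h5
        filter_upwards [hq1, h5] with x hx hx'
        rw [hx', sobolevEmbedding_apply, hx, Pi.smul_apply, smul_eq_mul]
        ring
      rw [← h3, ← h4]
      linarith

end Spectrum

/-! ### Functions with vanishing weak gradient. -/

section Constants

open Filter Metric

variable {d : ℕ} {Ω : Set (Euc d)}

/-- With zero gradient the translation estimate gives, for each small z, u(x + z) = u(x) for almost
every x. Exchanging the quantifiers yields one x that works for almost every z. -/
theorem IsH1.exists_ae_eq_const_ball [IsFiniteMeasure (volume.restrict Ω)] (hΩ : IsOpen Ω)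
    {u : Euc d → ℝ} {G : Euc d → Euc d} (hu : IsH1 Ω u G) (hum : StronglyMeasurable u)
    (hG : G =ᵐ[volume.restrict Ω] 0) {x₀ : Euc d} (hx₀ : x₀ ∈ Ω) :
    ∃ c : ℝ, ∃ r > 0, ∀ᵐ y ∂volume.restrict (ball x₀ r), u y = c := by
  obtain ⟨r', hr', hball⟩ := isOpen_iff.1 hΩ x₀ hx₀
  obtain ⟨r, hr, rfl⟩ : ∃ r, 0 < r ∧ r' = 2 * r := ⟨r' / 2, by positivity, by ring⟩
  have hG0 : eLpNorm G 2 (volume.restrict Ω) = 0 := by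
    rw [eLpNorm_congr_ae hG, eLpNorm_zero]
  have htrans : ∀ z ∈ ball (0 : Euc d) r, ∀ᵐ x ∂volume.restrict (ball x₀ r), u (x + z) = u x := by
    intro z hz
    have h1 := hu.eLpNorm_translate_sub_le hΩ (isOpen_ball (x := x₀) (ε := r)) z
      fun x hx t ht => hball (by
        rw [mem_ball, dist_eq_norm] at hx ⊢
        rw [mem_ball_zero_iff] at hz
        have h2 : ‖t • z‖ ≤ ‖z‖ := by
          rw [norm_smul, Real.norm_of_nonneg ht.1]
          exact mul_le_of_le_one_left (norm_nonneg z) ht.2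
        rw [show x + t • z - x₀ = (x - x₀) + t • z by abel]
        linarith [norm_add_le (x - x₀) (t • z)])
    rw [hG0, mul_zero, nonpos_iff_eq_zero, eLpNorm_eq_zero_iff _ two_ne_zero] at h1
    · filter_upwards [h1] with x hx
      exact sub_eq_zero.1 hx
    · have := hum.measurable
      exact Measurable.aestronglyMeasurable (by fun_prop)
  have hms : MeasurableSet {p : Euc d × Euc d | u (p.2 + p.1) = u p.2} := by
    have := hum.measurable
    exact measurableSet_eq_fun (by fun_prop) (by fun_prop)
  have h1 : ∀ᵐ z ∂volume.restrict (ball (0 : Euc d) r),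
      ∀ᵐ x ∂volume.restrict (ball x₀ r), u (x + z) = u x := by
    filter_upwards [ae_restrict_mem measurableSet_ball] with z hz
    exact htrans z hz
  rw [Measure.ae_ae_comm hms] at h1
  -- With x within r/2 of the centre, the translates of x by vectors shorter than r cover the half
  -- ball.
  have hle : ball x₀ (r / 2) ⊆ ball x₀ r := ball_subset_ball (by linarith)
  have hne : (volume.restrict (ball x₀ (r / 2))) ≠ 0 := by
    rw [Ne, Measure.restrict_eq_zero]
    exact (measure_ball_pos _ _ (half_pos hr)).ne'
  have : (ae (volume.restrict (ball x₀ (r / 2)))).NeBot := ae_neBot.2 hne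
  obtain ⟨x, hx1, hx2⟩ := ((ae_restrict_of_ae_restrict_of_subset hle h1).and
    (ae_restrict_mem measurableSet_ball)).exists
  refine ⟨u x, r / 2, half_pos hr, ?_⟩
  have hmp := (measurePreserving_sub_right volume x).restrict_preimage
    (s := ball (0 : Euc d) r) measurableSet_ball
  have h2 := hmp.quasiMeasurePreserving.ae hx1
  have hsub : ball x₀ (r / 2) ⊆ (fun y => y - x) ⁻¹' ball (0 : Euc d) r := fun y hy => by
    rw [Set.mem_preimage, mem_ball_zero_iff, ← dist_eq_norm]
    have h3 := mem_ball.1 hy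
    have h4 := mem_ball'.1 hx2
    linarith [dist_triangle y x₀ x]
  filter_upwards [ae_restrict_of_ae_restrict_of_subset hsub h2] with y hy
  simpa using hy

/-- A function with vanishing weak gradient on a connected open set is constant. -/
theorem IsH1.exists_ae_eq_const [IsFiniteMeasure (volume.restrict Ω)] (hΩ : IsOpen Ω)
    (hconn : IsConnected Ω) {u : Euc d → ℝ} {G : Euc d → Euc d} (hu : IsH1 Ω u G)
    (hum : StronglyMeasurable u) (hG : G =ᵐ[volume.restrict Ω] 0) :
    ∃ c : ℝ, ∀ᵐ y ∂volume.restrict Ω, u y = c := by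
  have hloc : ∀ x : Ω, ∃ c : ℝ, ∃ r > 0, ∀ᵐ y ∂volume.restrict (ball (x : Euc d) r), u y = c :=
    fun x => hu.exists_ae_eq_const_ball hΩ hum hG x.2
  choose c r hr hc using hloc
  -- Two intersecting balls meet in a set of positive measure, where both constants are values of u.
  have hlc : IsLocallyConstant c := by
    rw [IsLocallyConstant.iff_exists_open]
    refine fun x => ⟨Subtype.val ⁻¹' ball (x : Euc d) (r x), isOpen_ball.preimage
      continuous_subtype_val, mem_ball_self (hr x), fun x' hx' => ?_⟩
    have ho : IsOpen (ball (x : Euc d) (r x) ∩ ball (x' : Euc d) (r x')) :=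
      isOpen_ball.inter isOpen_ball
    have hne : (volume.restrict (ball (x : Euc d) (r x) ∩ ball (x' : Euc d) (r x'))) ≠ 0 := by
      rw [Ne, Measure.restrict_eq_zero]
      exact (ho.measure_pos volume ⟨x', hx', mem_ball_self (hr x')⟩).ne'
    have := ae_neBot.2 hne
    obtain ⟨y, hy1, hy2⟩ :=
      ((ae_restrict_of_ae_restrict_of_subset Set.inter_subset_left (hc x)).and
      (ae_restrict_of_ae_restrict_of_subset Set.inter_subset_right (hc x'))).exists
    exact hy2.symm.trans hy1
  have : PreconnectedSpace Ω := isPreconnected_iff_preconnectedSpace.1 hconn.isPreconnected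
  obtain ⟨x₀, hx₀⟩ := hconn.nonempty
  refine ⟨c ⟨x₀, hx₀⟩, ?_⟩
  rw [ae_restrict_iff' hΩ.measurableSet]
  have hnull : volume {y | y ∈ Ω ∧ u y ≠ c ⟨x₀, hx₀⟩} = 0 := by
    refine measure_null_of_locally_null _ fun x hx => ?_
    refine ⟨_, inter_mem self_mem_nhdsWithin
      (mem_nhdsWithin_of_mem_nhds (ball_mem_nhds x (hr ⟨x, hx.1⟩))), ?_⟩
    have h1 := hc ⟨x, hx.1⟩
    rw [hlc.apply_eq_of_preconnectedSpace ⟨x, hx.1⟩ ⟨x₀, hx₀⟩,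
      ae_restrict_iff' measurableSet_ball] at h1
    refine measure_mono_null (fun y hy => ?_) h1
    exact fun h => hy.1.2 (h hy.2)
  refine measure_mono_null (fun y hy => ?_) hnull
  simpa using hy

end Constants

/-! ### Properties shared by all eigensystems. -/

section Eigensystem

open Filter

variable {d : ℕ} {Ω : Set (Euc d)} {ρ : Euc d → ℝ} {lam : ℕ → ℝ} {φ : HilbertBasis ℕ ℝ (L2 Ω ρ)}

/-- Test the eigenvalue equation with the eigenfunction itself. -/
theorem IsEigensystem.exists_gradient (hρ : IsWeight Ω ρ) (h : IsEigensystem Ω ρ lam φ) (k : ℕ) :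
    ∃ G : Euc d → Euc d, IsH1 Ω (φ k) G ∧ ∫ x in Ω, ρ x ^ 2 * ‖G x‖ ^ 2 = lam k := by
  obtain ⟨G, hG, hw⟩ := h.eigen k
  refine ⟨G, hG, ?_⟩
  have h1 := hw _ _ hG
  simp only [real_inner_self_eq_norm_sq] at h1
  rw [h1]
  have h2 : inner ℝ (φ k) (φ k) = (1 : ℝ) := by
    rw [real_inner_self_eq_norm_sq, φ.orthonormal.norm_eq_one, one_pow]
  rw [hρ.integral_mul_eq_inner] at h2
  refine Eq.trans ?_ (mul_one (lam k))
  rw [← h2, ← integral_const_mul]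
  refine integral_congr_ae ?_
  have h5 := Lp.coeFn_smul (lam k) (φ k)
  rw [Filter.EventuallyEq, hρ.ae_eq] at h5
  filter_upwards [h5] with x hx
  rw [hx, Pi.smul_apply, smul_eq_mul]
  ring

theorem IsEigensystem.nonneg (hρ : IsWeight Ω ρ) (h : IsEigensystem Ω ρ lam φ) (k : ℕ) :
    0 ≤ lam k := by
  obtain ⟨G, -, hG⟩ := h.exists_gradient hρ k
  rw [← hG]
  exact integral_nonneg fun x => by positivity

/-- If the eigenvalues stayed below M, all eigenfunctions would lie in an H¹ ball of radius √(1 +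
|M|), hence in a compact subset of L²_μ; an infinite orthonormal family cannot. -/
theorem IsEigensystem.tendsto_atTop (hΩ : IsC11Domain Ω) (hρ : IsWeight Ω ρ)
    (h : IsEigensystem Ω ρ lam φ) : Tendsto lam atTop atTop := by
  have := hΩ.isFiniteMeasure
  refine tendsto_atTop_atTop_of_monotone h.monotone fun M => ?_
  by_contra! hM
  obtain ⟨K, hK, hKsub⟩ := (isCompactOperator_iff_image_closedBall_subset_compact
    (sobolevEmbedding Ω ρ : sobolevPairs Ω ρ →ₗ[ℝ] L2 Ω ρ)
    (show 0 < Real.sqrt (1 + |M|) by positivity)).1 (isCompactOperator_sobolevEmbedding hΩ hρ)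
  have hmem : ∀ k, φ k ∈ K := fun k => by
    obtain ⟨G, hG, hGint⟩ := h.exists_gradient hρ k
    obtain ⟨q, hq1, hq2⟩ := hG.exists_mem_sobolevPairs hρ
    have hq : (q : PairSpace Ω ρ).fst = φ k := by
      refine Lp.ext ?_
      rw [hρ.ae_eq]
      exact hq1
    refine hKsub ⟨q, ?_, hq⟩
    rw [mem_closedBall_zero_iff]
    refine Real.le_sqrt_of_sq_le ?_
    change ‖(q : PairSpace Ω ρ)‖ ^ 2 ≤ _
    rw [WithLp.prod_norm_sq_eq_of_L2, hq, φ.orthonormal.norm_eq_one, one_pow,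
      ← real_inner_self_eq_norm_sq, hρ.integral_inner_eq_inner]
    have h1 : ∫ x in Ω, ρ x ^ 2 * inner ℝ ((q : PairSpace Ω ρ).snd x) ((q : PairSpace Ω ρ).snd x)
        = lam k := by
      rw [← hGint]
      refine integral_congr_ae ?_
      filter_upwards [hq2] with x hx
      rw [hx, real_inner_self_eq_norm_sq]
    rw [h1]
    linarith [hM k, le_abs_self M]
  have hfin := finite_of_isCompact_of_separated hK one_pos (fun k => φ k) hmem fun i j hij => by
    change 1 ≤ dist (φ i) (φ j)
    rw [dist_eq_norm]
    refine le_of_sq_le_sq ?_ (norm_nonneg _)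
    rw [norm_sub_sq_real, φ.orthonormal.norm_eq_one, φ.orthonormal.norm_eq_one,
      φ.orthonormal.2 hij]
    norm_num
  exact not_finite ℕ

/-- Eigenfunctions with eigenvalue zero are constant. -/
theorem IsEigensystem.exists_eq_const (hΩ : IsC11Domain Ω) (hρ : IsWeight Ω ρ)
    (h : IsEigensystem Ω ρ lam φ) {k : ℕ} (hk : lam k = 0) :
    ∃ c : ℝ, c ≠ 0 ∧ ∀ᵐ x ∂(dataMeasure Ω ρ), φ k x = c := by
  have := hΩ.isFiniteMeasure
  obtain ⟨G, hG, hGint⟩ := h.exists_gradient hρ k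
  rw [hk] at hGint
  have hint : Integrable (fun x => ρ x ^ 2 * ‖G x‖ ^ 2) (volume.restrict Ω) := by
    obtain ⟨a, b, ha, hb, hab⟩ := hρ.sq.bounds
    refine (hG.memLp_grad.integrable_norm_pow two_ne_zero).bdd_mul (c := b)
      hρ.sq.aemeasurable.aestronglyMeasurable ?_
    filter_upwards [ae_restrict_mem hρ.measurableSet] with x hx
    rw [Real.norm_of_nonneg (by positivity)]
    exact (hab x hx).2
  rw [integral_eq_zero_iff_of_nonneg (fun x => by positivity) hint] at hGint
  have hG0 : G =ᵐ[volume.restrict Ω] 0 := by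
    filter_upwards [hGint, ae_restrict_mem hρ.measurableSet] with x hx hxΩ
    have h1 := (hρ.pos hxΩ).ne'
    have h2 : ρ x ^ 2 * ‖G x‖ ^ 2 = 0 := hx
    simpa [h1] using h2
  obtain ⟨c, hc⟩ := hG.exists_ae_eq_const hΩ.isOpen hΩ.isConnected (Lp.stronglyMeasurable _) hG0
  rw [← hρ.ae_eq] at hc
  refine ⟨c, ?_, hc⟩
  rintro rfl
  have h1 : φ k = 0 := (Lp.eq_zero_iff_ae_eq_zero).2 hc
  have h2 := φ.orthonormal.norm_eq_one k
  rw [h1, norm_zero] at h2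
  exact zero_ne_one h2

/-- The kernel of `𝓛` is one-dimensional. -/
theorem IsEigensystem.pos (hΩ : IsC11Domain Ω) (hρ : IsWeight Ω ρ)
    (h : IsEigensystem Ω ρ lam φ) {k : ℕ} (hk : k ≠ 0) : 0 < lam k := by
  refine lt_of_le_of_ne (h.nonneg hρ k) fun hk0 => ?_
  -- A second zero eigenvalue would make φ_0 and φ_k both nonzero constants, which are not
  -- orthogonal.
  have h0 : lam 0 = 0 := le_antisymm (hk0 ▸ h.monotone (Nat.zero_le k)) (h.nonneg hρ 0)
  obtain ⟨c, hc0, hc⟩ := h.exists_eq_const hΩ hρ h0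
  obtain ⟨c', hc0', hc'⟩ := h.exists_eq_const hΩ hρ hk0.symm
  have h1 : φ k = (c' / c) • φ 0 := by
    refine Lp.ext ?_
    filter_upwards [hc, hc', Lp.coeFn_smul (c' / c) (φ 0)] with x hx hx' hx''
    rw [hx'', hx', Pi.smul_apply, hx, smul_eq_mul]
    field_simp
  have h2 : inner ℝ (φ k) (φ 0) = (0 : ℝ) := φ.orthonormal.2 hk
  rw [h1, real_inner_smul_left, real_inner_self_eq_norm_sq, φ.orthonormal.norm_eq_one] at h2
  have : c' / c ≠ 0 := div_ne_zero hc0' hc0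
  simp at h2
  tauto

end Eigensystem

/-! ### The quadratic form. -/

section QuadraticForm

open Filter

variable {d : ℕ} {Ω : Set (Euc d)} {ρ : Euc d → ℝ} {lam : ℕ → ℝ} {φ : HilbertBasis ℕ ℝ (L2 Ω ρ)}
  {α τ : ℝ}

theorem lowerSemicontinuous_quadraticForm :
    LowerSemicontinuous (quadraticForm lam φ α τ) := by
  have e : quadraticForm lam φ α τ = fun u =>
      ∑' k, 2⁻¹ * ENNReal.ofReal ((lam k + τ ^ 2) ^ α * (inner ℝ u (φ k)) ^ 2) :=
    funext fun u => ENNReal.tsum_mul_left.symm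
  rw [e]
  refine lowerSemicontinuous_tsum fun k => Continuous.lowerSemicontinuous ?_
  refine (ENNReal.continuous_const_mul (by simp)).comp (ENNReal.continuous_ofReal.comp ?_)
  fun_prop

theorem quadraticForm_zero : quadraticForm lam φ α τ 0 = 0 := by
  simp [quadraticForm]

theorem weight_nonneg (hlam : ∀ k, 0 ≤ lam k) (k : ℕ) : 0 ≤ (lam k + τ ^ 2) ^ α := by
  have := hlam k
  positivity

theorem hasSum_of_quadraticForm_le (hlam : ∀ k, 0 ≤ lam k) {M : ℝ} (hM : 0 ≤ M) {u : L2 Ω ρ}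
    (h : quadraticForm lam φ α τ u ≤ ENNReal.ofReal M) :
    (Summable fun k => (lam k + τ ^ 2) ^ α * inner ℝ u (φ k) ^ 2) ∧
      ∑' k, (lam k + τ ^ 2) ^ α * inner ℝ u (φ k) ^ 2 ≤ 2 * M := by
  have h0 : ∀ k, 0 ≤ (lam k + τ ^ 2) ^ α * inner ℝ u (φ k) ^ 2 := fun k =>
    mul_nonneg (weight_nonneg hlam k) (sq_nonneg _)
  have h1 : ∑' k, ENNReal.ofReal ((lam k + τ ^ 2) ^ α * inner ℝ u (φ k) ^ 2) ≤
      ENNReal.ofReal (2 * M) := by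
    rw [quadraticForm] at h
    rw [ENNReal.ofReal_mul zero_le_two, ENNReal.ofReal_ofNat]
    rwa [ENNReal.inv_mul_le_iff (by simp) (by simp)] at h
  have hs : Summable fun k => (lam k + τ ^ 2) ^ α * inner ℝ u (φ k) ^ 2 := by
    have := ENNReal.summable_toReal (h1.trans_lt ENNReal.ofReal_lt_top).ne
    refine this.congr fun k => ?_
    exact ENNReal.toReal_ofReal (h0 k)
  refine ⟨hs, ?_⟩
  rwa [← ENNReal.ofReal_tsum_of_nonneg h0 hs, ENNReal.ofReal_le_ofReal_iff (by positivity)] at h1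

/-- Comparison of λ_k^α with (λ_k + τ²)^α. It permits minimizing over all of L²_μ. -/
theorem mem_spectralSobolev_of_quadraticForm_ne_top (hlam : ∀ k, 0 ≤ lam k) (hα : 0 ≤ α)
    {u : L2 Ω ρ} (h : quadraticForm lam φ α τ u ≠ ⊤) : u ∈ spectralSobolev lam φ α := by
  have hs := (hasSum_of_quadraticForm_le hlam ENNReal.toReal_nonneg
    (ENNReal.ofReal_toReal h).ge).1
  refine Summable.of_nonneg_of_le (fun k => ?_) (fun k => ?_) hs
  · have := hlam k
    positivity
  · have := hlam k
    have h1 : lam k ≤ lam k + τ ^ 2 := by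
      have := sq_nonneg τ
      linarith
    gcongr

/-- Holds mode by mode. Uniqueness needs the identity and not only convexity: it measures the gain
at a midpoint by the form of the difference. -/
theorem quadraticForm_parallelogram (hlam : ∀ k, 0 ≤ lam k) (u v : L2 Ω ρ) :
    quadraticForm lam φ α τ ((1 / 2 : ℝ) • (u + v)) +
      quadraticForm lam φ α τ ((1 / 2 : ℝ) • (u - v)) =
      2⁻¹ * (quadraticForm lam φ α τ u + quadraticForm lam φ α τ v) := by
  have h0 : ∀ (x : L2 Ω ρ) k, 0 ≤ (lam k + τ ^ 2) ^ α * inner ℝ x (φ k) ^ 2 := fun x k =>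
    mul_nonneg (weight_nonneg hlam k) (sq_nonneg _)
  simp only [quadraticForm]
  rw [← mul_add, ← mul_add, ← ENNReal.tsum_add, ← ENNReal.tsum_add]
  congr 1
  rw [← ENNReal.tsum_mul_left]
  refine tsum_congr fun k => ?_
  have h2 : (2⁻¹ : ℝ≥0∞) = ENNReal.ofReal (1 / 2) := by
    rw [one_div, ENNReal.ofReal_inv_of_pos zero_lt_two, ENNReal.ofReal_ofNat]
  rw [← ENNReal.ofReal_add (h0 _ _) (h0 _ _), ← ENNReal.ofReal_add (h0 _ _) (h0 _ _), h2,
    ← ENNReal.ofReal_mul (by norm_num)]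
  congr 1
  rw [real_inner_smul_left, real_inner_smul_left, inner_add_left, inner_sub_left]
  ring

theorem weight_mul_sq_eq_zero (hlam : ∀ k, 0 ≤ lam k) {u : L2 Ω ρ}
    (h : quadraticForm lam φ α τ u = 0) (k : ℕ) :
    (lam k + τ ^ 2) ^ α * inner ℝ u (φ k) ^ 2 = 0 := by
  simp only [quadraticForm, mul_eq_zero, ENNReal.inv_eq_zero, ENNReal.ofNat_ne_top, false_or,
    ENNReal.tsum_eq_zero, ENNReal.ofReal_eq_zero] at h
  exact le_antisymm (h k) (mul_nonneg (weight_nonneg hlam k) (sq_nonneg _))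

theorem weight_mul_sq_le (hlam : ∀ k, 0 ≤ lam k) {M : ℝ} (hM : 0 ≤ M) {u : L2 Ω ρ}
    (h : quadraticForm lam φ α τ u ≤ ENNReal.ofReal M) (k : ℕ) :
    (lam k + τ ^ 2) ^ α * inner ℝ u (φ k) ^ 2 ≤ 2 * M := by
  obtain ⟨hs, hle⟩ := hasSum_of_quadraticForm_le hlam hM h
  exact (hs.le_tsum k fun j _ => mul_nonneg (weight_nonneg hlam j) (sq_nonneg _)).trans hle

/-- The quadratic form controls the part of `u` that is orthogonal to the first eigenfunction. -/
theorem norm_sub_sq_le_of_quadraticForm_le (hlam : ∀ k, 0 ≤ lam k) (hmono : Monotone lam)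
    (hlam1 : 0 < lam 1) (hα : 0 ≤ α) {M : ℝ} (hM : 0 ≤ M) {u : L2 Ω ρ}
    (h : quadraticForm lam φ α τ u ≤ ENNReal.ofReal M) :
    ‖u - inner ℝ u (φ 0) • φ 0‖ ^ 2 ≤ 2 * M / (lam 1 + τ ^ 2) ^ α := by
  obtain ⟨hs, hle⟩ := hasSum_of_quadraticForm_le hlam hM h
  have hw1 : 0 < (lam 1 + τ ^ 2) ^ α := by positivity
  rw [le_div_iff₀ hw1]
  refine le_trans ?_ hle
  refine hasSum_le (fun k => ?_) ((hasSum_inner_sq φ _).mul_right _) hs.hasSum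
  rw [inner_sub_left, real_inner_smul_left]
  rcases Nat.eq_zero_or_pos k with rfl | hk
  · rw [real_inner_self_eq_norm_sq, φ.orthonormal.norm_eq_one]
    have := weight_nonneg (τ := τ) (α := α) hlam 0
    have h2 : inner ℝ u (φ 0) - inner ℝ u (φ 0) * (1 : ℝ) ^ 2 = 0 := by ring
    rw [h2, zero_pow two_ne_zero, zero_mul]
    positivity
  · have h1 : inner ℝ (φ 0) (φ k) = (0 : ℝ) := φ.orthonormal.2 hk.ne
    rw [h1, mul_zero, sub_zero, mul_comm]
    have h2 := hmono (show 1 ≤ k from hk)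
    gcongr

end QuadraticForm

/-! ### The label term: semicontinuity, convexity and control of means. -/

section LabelTerm

open Filter

variable {d : ℕ} {Ω Ω' Ωpos Ωneg : Set (Euc d)} {ρ y : Euc d → ℝ} {γ : ℝ}

theorem labelTerm_congr (hm : MeasurableSet Ω') {y' : Euc d → ℝ} (h : ∀ x ∈ Ω', y x = y' x) :
    labelTerm (ρ := ρ) (Ω := Ω) Ω' y γ = labelTerm Ω' y' γ := by
  funext v
  refine setLIntegral_congr_fun hm fun x hx => ?_
  simp only [h x hx]

theorem measurable_labelIntegrand (hγ : 0 < γ) (hy : Measurable y) (v : L2 Ω ρ) :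
    Measurable fun x => ENNReal.ofReal (-Real.log (Psi (y x * v x) γ)) := by
  have h1 := (continuous_log_Psi hγ).measurable
  have h2 : Measurable v := (Lp.stronglyMeasurable v).measurable
  exact ENNReal.measurable_ofReal.comp (h1.comp (hy.mul h2)).neg

/-- Fatou's lemma along an a.e. convergent subsequence of an L²-convergent sequence. -/
theorem lowerSemicontinuous_labelTerm (hγ : 0 < γ) (hy : Measurable y) :
    LowerSemicontinuous (labelTerm (ρ := ρ) (Ω := Ω) Ω' y γ) := by
  intro v a ha
  by_contra hnot
  rw [not_eventually] at hnot
  obtain ⟨x, hx, hxa⟩ := exists_seq_forall_of_frequently hnot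
  obtain ⟨ns, hns, hae⟩ := (tendstoInMeasure_of_tendsto_Lp hx).exists_seq_tendsto_ae
  have hlim : ∀ᵐ z ∂(dataMeasure Ω ρ).restrict Ω',
      ENNReal.ofReal (-Real.log (Psi (y z * v z) γ)) =
        liminf (fun n => ENNReal.ofReal (-Real.log (Psi (y z * x (ns n) z) γ))) atTop := by
    filter_upwards [ae_restrict_of_ae hae] with z hz
    have hc : Continuous fun s => ENNReal.ofReal (-Real.log (Psi (y z * s) γ)) :=
      ENNReal.continuous_ofReal.comp ((continuous_log_Psi hγ).comp (by fun_prop)).neg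
    exact ((hc.tendsto _).comp hz).liminf_eq.symm
  have h1 : labelTerm Ω' y γ v ≤ liminf (fun n => labelTerm Ω' y γ (x (ns n))) atTop := by
    rw [labelTerm, lintegral_congr_ae hlim]
    exact lintegral_liminf_le fun n => measurable_labelIntegrand hγ hy _
  have h2 : liminf (fun n => labelTerm Ω' y γ (x (ns n))) atTop ≤ a := by
    refine (liminf_le_limsup).trans (limsup_le_of_le (by isBoundedDefault) ?_)
    exact Eventually.of_forall fun n => not_lt.1 (hxa (ns n))
  exact absurd ha (not_lt.2 (h1.trans h2))

theorem labelTerm_zero_ne_top [IsFiniteMeasure (dataMeasure Ω ρ)] :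
    labelTerm (ρ := ρ) (Ω := Ω) Ω' y γ 0 ≠ ⊤ := by
  have h : labelTerm (ρ := ρ) (Ω := Ω) Ω' y γ 0 =
      ∫⁻ _ in Ω', ENNReal.ofReal (-Real.log (Psi 0 γ)) ∂(dataMeasure Ω ρ) := by
    refine lintegral_congr_ae (ae_restrict_of_ae ?_)
    filter_upwards [Lp.coeFn_zero ℝ 2 (dataMeasure Ω ρ)] with x hx
    rw [hx, Pi.zero_apply, mul_zero]
  rw [h, lintegral_const]
  finiteness

theorem half_smul_add_ae (u v : L2 Ω ρ) :
    ∀ᵐ x ∂(dataMeasure Ω ρ), ((1 / 2 : ℝ) • (u + v) : L2 Ω ρ) x = (u x + v x) / 2 := by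
  filter_upwards [Lp.coeFn_smul (1 / 2 : ℝ) (u + v), Lp.coeFn_add u v] with x hx hx'
  rw [hx, Pi.smul_apply, hx', Pi.add_apply, smul_eq_mul]
  ring

theorem inv_two_mul_labelTerm_add (hγ : 0 < γ) (hy : Measurable y) (u v : L2 Ω ρ) :
    2⁻¹ * (labelTerm Ω' y γ u + labelTerm Ω' y γ v) =
      ∫⁻ x in Ω', ENNReal.ofReal ((-Real.log (Psi (y x * u x) γ) +
        -Real.log (Psi (y x * v x) γ)) / 2) ∂(dataMeasure Ω ρ) := by
  rw [labelTerm, labelTerm, ← lintegral_add_left (measurable_labelIntegrand hγ hy u),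
    ← lintegral_const_mul' _ _ (by simp)]
  refine lintegral_congr fun x => ?_
  have h2 : (2⁻¹ : ℝ≥0∞) = ENNReal.ofReal (1 / 2) := by
    rw [one_div, ENNReal.ofReal_inv_of_pos zero_lt_two, ENNReal.ofReal_ofNat]
  rw [← ENNReal.ofReal_add (neg_log_Psi_pos hγ _).le (neg_log_Psi_pos hγ _).le, h2,
    ← ENNReal.ofReal_mul (by norm_num)]
  congr 1
  ring

theorem labelTerm_midpoint_le (hγ : 0 < γ) (hy : Measurable y) (u v : L2 Ω ρ) :
    labelTerm Ω' y γ ((1 / 2 : ℝ) • (u + v)) ≤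
      2⁻¹ * (labelTerm Ω' y γ u + labelTerm Ω' y γ v) := by
  rw [inv_two_mul_labelTerm_add hγ hy]
  refine lintegral_mono_ae (ae_restrict_of_ae ?_)
  filter_upwards [half_smul_add_ae u v] with x hx
  rw [hx, show y x * ((u x + v x) / 2) = (y x * u x + y x * v x) / 2 by ring]
  exact ENNReal.ofReal_le_ofReal (neg_log_Psi_midpoint_le hγ _ _)

/-- The inequality is strict at almost every point of a set of positive measure, and finiteness lets
strictness survive integration. -/
theorem labelTerm_midpoint_lt (hγ : 0 < γ) (hy : Measurable y) (hΩ' : MeasurableSet Ω')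
    (hΩ'0 : dataMeasure Ω ρ Ω' ≠ 0) (hy0 : ∀ x ∈ Ω', y x ≠ 0) {u v : L2 Ω ρ}
    (huv : ∀ᵐ x ∂(dataMeasure Ω ρ), u x ≠ v x)
    (hu : labelTerm Ω' y γ u ≠ ⊤) (hv : labelTerm Ω' y γ v ≠ ⊤) :
    labelTerm Ω' y γ ((1 / 2 : ℝ) • (u + v)) <
      2⁻¹ * (labelTerm Ω' y γ u + labelTerm Ω' y γ v) := by
  have hfin : labelTerm Ω' y γ ((1 / 2 : ℝ) • (u + v)) ≠ ⊤ :=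
    ((labelTerm_midpoint_le hγ hy u v).trans_lt (by finiteness)).ne
  rw [inv_two_mul_labelTerm_add hγ hy]
  refine lintegral_strict_mono (by rwa [Ne, Measure.restrict_eq_zero]) ?_ hfin ?_
  · have h1 := (continuous_log_Psi hγ).measurable
    have hu2 : Measurable u := (Lp.stronglyMeasurable u).measurable
    have hv2 : Measurable v := (Lp.stronglyMeasurable v).measurable
    exact (ENNReal.measurable_ofReal.comp
      (((h1.comp (hy.mul hu2)).neg.add (h1.comp (hy.mul hv2)).neg).div_const 2)).aemeasurable
  · filter_upwards [ae_restrict_of_ae (half_smul_add_ae u v), ae_restrict_of_ae huv,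
      ae_restrict_mem hΩ'] with x hx hx' hxΩ
    rw [hx, show y x * ((u x + v x) / 2) = (y x * u x + y x * v x) / 2 by ring]
    have h1 := neg_log_Psi_midpoint_lt hγ (s := y x * u x) (t := y x * v x)
      fun h => hx' (mul_left_cancel₀ (hy0 x hxΩ) h)
    exact (ENNReal.ofReal_lt_ofReal_iff ((neg_log_Psi_pos hγ _).trans h1)).2 h1

/-- The label term controls the mean of `-s v` over a set on which the label is `s`. -/
theorem neg_hazard_mul_setIntegral_le [IsFiniteMeasure (dataMeasure Ω ρ)] (hγ : 0 < γ) {M : ℝ}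
    (hM : 0 ≤ M) {v : L2 Ω ρ} (h : labelTerm Ω' y γ v ≤ ENNReal.ofReal M) {B : Set (Euc d)}
    (hB : MeasurableSet B) (hBΩ : B ⊆ Ω') {s : ℝ} (hs : ∀ x ∈ B, y x = s) :
    -(hazard γ 0 * (s * ∫ x in B, v x ∂(dataMeasure Ω ρ))) ≤ M := by
  have hint : Integrable v (dataMeasure Ω ρ) := (Lp.memLp v).integrable one_le_two
  have h1 : ∫⁻ x in B, ENNReal.ofReal (-(hazard γ 0 * (s * v x))) ∂(dataMeasure Ω ρ) ≤
      ENNReal.ofReal M := by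
    refine le_trans ?_ ((lintegral_mono_set hBΩ).trans h)
    refine setLIntegral_mono' hB fun x hx => ?_
    rw [hs x hx]
    exact ENNReal.ofReal_le_ofReal (neg_mul_le_neg_log_Psi hγ _)
  have h2 : Integrable (fun x => -(hazard γ 0 * (s * v x))) ((dataMeasure Ω ρ).restrict B) :=
    ((hint.integrableOn.const_mul s).const_mul _).neg
  have h3 : ∫ x in B, -(hazard γ 0 * (s * v x)) ∂(dataMeasure Ω ρ) ≤ M := by
    rw [integral_eq_lintegral_pos_part_sub_lintegral_neg_part h2]
    have h4 := ENNReal.toReal_mono ENNReal.ofReal_ne_top h1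
    rw [ENNReal.toReal_ofReal hM] at h4
    exact (sub_le_self _ ENNReal.toReal_nonneg).trans h4
  rwa [integral_neg, integral_const_mul, integral_const_mul] at h3

end LabelTerm

/-! ### Coercivity, existence and uniqueness. -/

section Minimizer

open Filter

variable {d : ℕ} {Ω Ωpos Ωneg : Set (Euc d)} {ρ y : Euc d → ℝ} {lam : ℕ → ℝ}
  {φ : HilbertBasis ℕ ℝ (L2 Ω ρ)} {α τ γ : ℝ}

theorem abs_setIntegral_le_norm [IsProbabilityMeasure (dataMeasure Ω ρ)] (v : L2 Ω ρ)
    (B : Set (Euc d)) : |∫ x in B, v x ∂(dataMeasure Ω ρ)| ≤ ‖v‖ := by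
  have hint : Integrable v (dataMeasure Ω ρ) := (Lp.memLp v).integrable one_le_two
  have h1 : |∫ x in B, v x ∂(dataMeasure Ω ρ)| ≤ ∫ x, ‖v x‖ ∂(dataMeasure Ω ρ) :=
    (norm_integral_le_integral_norm _).trans
      (setIntegral_le_integral hint.norm (Eventually.of_forall fun _ => norm_nonneg _))
  have h2 := integral_norm_mul_norm_le (Lp.memLp v)
    (memLp_const (μ := dataMeasure Ω ρ) (p := 2) (1 : ℝ))
  simp only [norm_one, mul_one] at h2
  refine h1.trans (h2.trans (le_of_eq ?_))
  rw [eLpNorm_const _ two_ne_zero (IsProbabilityMeasure.ne_zero _), measure_univ,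
    ENNReal.one_rpow, Lp.norm_def]
  simp

theorem IsWeight.measure_ne_zero (hρ : IsWeight Ω ρ) {B : Set (Euc d)} (hB : MeasurableSet B)
    (hBΩ : B ⊆ Ω) (h : 0 < volume B) : dataMeasure Ω ρ B ≠ 0 := by
  intro h0
  rw [measure_eq_zero_iff_ae_notMem, hρ.ae_eq, ← measure_eq_zero_iff_ae_notMem,
    Measure.restrict_apply hB, Set.inter_eq_left.2 hBΩ] at h0
  exact h.ne' h0

/-- Sublevel sets of the probit functional are bounded. -/
theorem IsEigensystem.exists_norm_le (hΩ : IsC11Domain Ω) (hρ : IsWeight Ω ρ)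
    [IsProbabilityMeasure (dataMeasure Ω ρ)] (h : IsEigensystem Ω ρ lam φ)
    (hy : IsLabelling Ω Ωpos Ωneg y) (hα : 1 ≤ α) (hγ : 0 < γ) {M : ℝ} (hM : 0 ≤ M) :
    ∃ R : ℝ, ∀ v : L2 Ω ρ, probit lam φ α τ (Ωpos ∪ Ωneg) y γ v ≤ ENNReal.ofReal M → ‖v‖ ≤ R := by
  have hlam := h.nonneg hρ
  have hlam1 := h.pos hΩ hρ one_ne_zero
  set R₁ := Real.sqrt (2 * M / (lam 1 + τ ^ 2) ^ α) with hR₁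
  have hperp : ∀ v : L2 Ω ρ, probit lam φ α τ (Ωpos ∪ Ωneg) y γ v ≤ ENNReal.ofReal M →
      ‖v - inner ℝ v (φ 0) • φ 0‖ ≤ R₁ := fun v hv =>
    Real.le_sqrt_of_sq_le (norm_sub_sq_le_of_quadraticForm_le hlam h.monotone hlam1 (by linarith)
      hM (le_self_add.trans hv))
  suffices hc : ∃ R₀ : ℝ, ∀ v : L2 Ω ρ, probit lam φ α τ (Ωpos ∪ Ωneg) y γ v ≤ ENNReal.ofReal M →
      |inner ℝ v (φ 0)| ≤ R₀ by
    obtain ⟨R₀, hR₀⟩ := hc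
    refine ⟨R₁ + R₀, fun v hv => ?_⟩
    have h1 : v = (v - inner ℝ v (φ 0) • φ 0) + inner ℝ v (φ 0) • φ 0 := by abel
    rw [h1]
    refine (norm_add_le _ _).trans (add_le_add (hperp v hv) ?_)
    rw [norm_smul, φ.orthonormal.norm_eq_one, mul_one]
    exact hR₀ v hv
  -- If the weight of mode 0 is positive, the form bounds this coefficient too. Otherwise φ_0 is a
  -- constant c and only the labels can bound it.
  rcases (weight_nonneg (τ := τ) (α := α) hlam 0).eq_or_lt with hw | hw
  · have hlam0 : lam 0 = 0 := by
      have h1 : lam 0 + τ ^ 2 = 0 := by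
        refine (Real.rpow_eq_zero ?_ (by linarith)).1 hw.symm
        have := hlam 0
        positivity
      have := hlam 0
      have := sq_nonneg τ
      linarith
    obtain ⟨c, hc0, hc⟩ := h.exists_eq_const hΩ hρ hlam0
    set p := (dataMeasure Ω ρ).real Ωpos with hp
    set q := (dataMeasure Ω ρ).real Ωneg with hq
    have hp0 : 0 < p := ENNReal.toReal_pos
      (hρ.measure_ne_zero hy.measurable_pos hy.subset_pos hy.volume_pos) (measure_ne_top _ _)
    have hq0 : 0 < q := ENNReal.toReal_pos
      (hρ.measure_ne_zero hy.measurable_neg hy.subset_neg hy.volume_neg) (measure_ne_top _ _)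
    have hκ := hazard_pos hγ 0
    set T := M / hazard γ 0 + R₁ with hT
    have hT0 : 0 ≤ T := by positivity
    refine ⟨(T / p + T / q) / |c|, fun v hv => ?_⟩
    have hΦ : labelTerm (Ωpos ∪ Ωneg) y γ v ≤ ENNReal.ofReal M := le_add_self.trans hv
    set a := inner ℝ v (φ 0) with ha
    -- On each set B the integral of v is that of its constant part a c, up to R₁. With the label
    -- bound, Ω⁺ then limits a c from below and Ω⁻ from above.
    have hint : ∀ B : Set (Euc d), |(∫ x in B, v x ∂(dataMeasure Ω ρ)) -
        a * c * (dataMeasure Ω ρ).real B| ≤ R₁ := fun B => by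
      refine le_trans (le_of_eq ?_) ((abs_setIntegral_le_norm _ B).trans (hperp v hv))
      congr 1
      have hvint : Integrable v (dataMeasure Ω ρ) := (Lp.memLp v).integrable one_le_two
      have h1 : ∫ x in B, (v - a • φ 0 : L2 Ω ρ) x ∂(dataMeasure Ω ρ) =
          ∫ x in B, (v x - a * c) ∂(dataMeasure Ω ρ) := by
        refine integral_congr_ae (ae_restrict_of_ae ?_)
        filter_upwards [Lp.coeFn_sub v (a • φ 0), Lp.coeFn_smul a (φ 0), hc] with x h1 h2 h3
        rw [h1, Pi.sub_apply, h2, Pi.smul_apply, h3, smul_eq_mul]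
      rw [h1, integral_sub hvint.integrableOn (integrable_const _), setIntegral_const, smul_eq_mul]
      ring
    have hpos := neg_hazard_mul_setIntegral_le hγ hM hΦ hy.measurable_pos
      Set.subset_union_left hy.label_pos
    have hneg := neg_hazard_mul_setIntegral_le hγ hM hΦ hy.measurable_neg
      Set.subset_union_right hy.label_neg
    have h1 := abs_le.1 (hint Ωpos)
    have h2 := abs_le.1 (hint Ωneg)
    have h3 : -(∫ x in Ωpos, v x ∂(dataMeasure Ω ρ)) ≤ M / hazard γ 0 := by
      rw [le_div_iff₀ hκ]
      linarith
    have h4 : ∫ x in Ωneg, v x ∂(dataMeasure Ω ρ) ≤ M / hazard γ 0 := by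
      rw [le_div_iff₀ hκ]
      linarith
    have h5 : -(a * c) ≤ T / p := by
      rw [le_div_iff₀ hp0]
      linarith [h1.1, h1.2]
    have h6 : a * c ≤ T / q := by
      rw [le_div_iff₀ hq0]
      linarith [h2.1, h2.2]
    rw [le_div_iff₀ (abs_pos.2 hc0), ← abs_mul]
    have h7 : 0 ≤ T / p := by positivity
    have h8 : 0 ≤ T / q := by positivity
    exact abs_le.2 ⟨by linarith, by linarith⟩
  · refine ⟨Real.sqrt (2 * M / (lam 0 + τ ^ 2) ^ α), fun v hv => Real.abs_le_sqrt ?_⟩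
    rw [le_div_iff₀ hw, mul_comm]
    exact weight_mul_sq_le hlam hM (le_self_add.trans hv) 0

theorem tendsto_weight_atTop (h : Tendsto lam atTop atTop) (hα : 1 ≤ α) :
    Tendsto (fun k => (lam k + τ ^ 2) ^ α) atTop atTop := by
  have h1 : Tendsto (fun k => lam k + τ ^ 2) atTop atTop :=
    tendsto_atTop_add_const_right _ _ h
  exact (tendsto_rpow_atTop (by linarith)).comp h1

/-- Direct method on the sublevel set at the finite value taken at 0. It is closed by
semicontinuity, bounded by coercivity, and compact because the weights tend to infinity. -/
theorem IsEigensystem.exists_forall_probit_le (hΩ : IsC11Domain Ω) (hρ : IsWeight Ω ρ)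
    [IsProbabilityMeasure (dataMeasure Ω ρ)] (h : IsEigensystem Ω ρ lam φ)
    (hy : IsLabelling Ω Ωpos Ωneg y) (hym : Measurable y) (hα : 1 ≤ α) (hγ : 0 < γ) :
    ∃ v : L2 Ω ρ, ∀ u, probit lam φ α τ (Ωpos ∪ Ωneg) y γ v ≤
      probit lam φ α τ (Ωpos ∪ Ωneg) y γ u := by
  have hlam := h.nonneg hρ
  have hlsc : LowerSemicontinuous (probit lam φ α τ (Ωpos ∪ Ωneg) y γ) :=
    lowerSemicontinuous_quadraticForm.add (lowerSemicontinuous_labelTerm hγ hym)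
  have h0 : probit lam φ α τ (Ωpos ∪ Ωneg) y γ 0 ≠ ⊤ := by
    rw [probit, quadraticForm_zero, zero_add]
    exact labelTerm_zero_ne_top
  set M := (probit lam φ α τ (Ωpos ∪ Ωneg) y γ 0).toReal with hM
  have hM0 : 0 ≤ M := ENNReal.toReal_nonneg
  have hMe : ENNReal.ofReal M = probit lam φ α τ (Ωpos ∪ Ωneg) y γ 0 := ENNReal.ofReal_toReal h0
  let s := {v : L2 Ω ρ | probit lam φ α τ (Ωpos ∪ Ωneg) y γ v ≤ ENNReal.ofReal M}
  have hs0 : (0 : L2 Ω ρ) ∈ s := hMe.ge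
  have hscl : IsClosed s := hlsc.isClosed_preimage _
  have hscomp : IsCompact s := by
    refine IsSeqCompact.isCompact fun x hx => ?_
    obtain ⟨R, hR⟩ := h.exists_norm_le hΩ hρ hy hα hγ (τ := τ) hM0
    obtain ⟨v, ns, hns, hv⟩ := exists_subseq_tendsto_of_weighted_bound φ
      (weight_nonneg (τ := τ) (α := α) hlam)
      (tendsto_weight_atTop (h.tendsto_atTop hΩ hρ) hα) (fun n => hR _ (hx n))
      (fun n => (hasSum_of_quadraticForm_le hlam hM0 (le_self_add.trans (hx n))).1)
      (fun n => (hasSum_of_quadraticForm_le hlam hM0 (le_self_add.trans (hx n))).2)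
    exact ⟨v, hscl.mem_of_tendsto hv (Eventually.of_forall fun n => hx _), ns, hns, hv⟩
  obtain ⟨v, hvs, hv⟩ := (hlsc.lowerSemicontinuousOn s).exists_isMinOn ⟨0, hs0⟩ hscomp
  refine ⟨v, fun u => ?_⟩
  by_cases hu : u ∈ s
  · exact hv hu
  · exact le_trans hvs (not_le.1 hu).le

theorem IsEigensystem.eq_of_forall_probit_le (hΩ : IsC11Domain Ω) (hρ : IsWeight Ω ρ)
    [IsProbabilityMeasure (dataMeasure Ω ρ)] (h : IsEigensystem Ω ρ lam φ)
    (hy : IsLabelling Ω Ωpos Ωneg y) (hym : Measurable y) (hα : 1 ≤ α) (hγ : 0 < γ)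
    {v w : L2 Ω ρ}
    (hv : ∀ u, probit lam φ α τ (Ωpos ∪ Ωneg) y γ v ≤ probit lam φ α τ (Ωpos ∪ Ωneg) y γ u)
    (hw : ∀ u, probit lam φ α τ (Ωpos ∪ Ωneg) y γ w ≤ probit lam φ α τ (Ωpos ∪ Ωneg) y γ u) :
    v = w := by
  by_contra hne
  have hlam := h.nonneg hρ
  have h0 : probit lam φ α τ (Ωpos ∪ Ωneg) y γ 0 ≠ ⊤ := by
    rw [probit, quadraticForm_zero, zero_add]
    exact labelTerm_zero_ne_top
  have hvtop : probit lam φ α τ (Ωpos ∪ Ωneg) y γ v ≠ ⊤ := ((hv 0).trans_lt h0.lt_top).ne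
  have hwv : probit lam φ α τ (Ωpos ∪ Ωneg) y γ w = probit lam φ α τ (Ωpos ∪ Ωneg) y γ v :=
    le_antisymm (hw v) (hv w)
  have havg : 2⁻¹ * (quadraticForm lam φ α τ v + quadraticForm lam φ α τ w) +
      2⁻¹ * (labelTerm (Ωpos ∪ Ωneg) y γ v + labelTerm (Ωpos ∪ Ωneg) y γ w) =
      probit lam φ α τ (Ωpos ∪ Ωneg) y γ v := by
    rw [← mul_add, add_add_add_comm]
    change 2⁻¹ * (probit lam φ α τ (Ωpos ∪ Ωneg) y γ v +
      probit lam φ α τ (Ωpos ∪ Ωneg) y γ w) = _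
    rw [hwv, ← two_mul, ← mul_assoc, ENNReal.inv_mul_cancel two_ne_zero (by simp), one_mul]
  have hpar := quadraticForm_parallelogram (α := α) (τ := τ) (φ := φ) hlam v w
  have hmid := hv ((1 / 2 : ℝ) • (v + w))
  have hle := labelTerm_midpoint_le (Ω' := Ωpos ∪ Ωneg) hγ hym v w
  have hQmid : quadraticForm lam φ α τ ((1 / 2 : ℝ) • (v + w)) ≤
      2⁻¹ * (quadraticForm lam φ α τ v + quadraticForm lam φ α τ w) := by
    rw [← hpar]
    exact le_self_add
  -- The midpoint value is at least the minimum, while the parallelogram law and convexity put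
  -- midpoint value plus this term below the minimum.
  have hQdiff : quadraticForm lam φ α τ ((1 / 2 : ℝ) • (v - w)) = 0 := by
    have h1 : probit lam φ α τ (Ωpos ∪ Ωneg) y γ v +
        quadraticForm lam φ α τ ((1 / 2 : ℝ) • (v - w)) ≤
        probit lam φ α τ (Ωpos ∪ Ωneg) y γ v + 0 := by
      calc _ ≤ probit lam φ α τ (Ωpos ∪ Ωneg) y γ ((1 / 2 : ℝ) • (v + w)) +
            quadraticForm lam φ α τ ((1 / 2 : ℝ) • (v - w)) := by gcongr
        _ = (quadraticForm lam φ α τ ((1 / 2 : ℝ) • (v + w)) +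
            quadraticForm lam φ α τ ((1 / 2 : ℝ) • (v - w))) +
            labelTerm (Ωpos ∪ Ωneg) y γ ((1 / 2 : ℝ) • (v + w)) := by
              rw [probit]
              ring
        _ ≤ 2⁻¹ * (quadraticForm lam φ α τ v + quadraticForm lam φ α τ w) +
            2⁻¹ * (labelTerm (Ωpos ∪ Ωneg) y γ v + labelTerm (Ωpos ∪ Ωneg) y γ w) := by
              rw [hpar]
              gcongr
        _ = _ := by rw [havg, add_zero]
    exact nonpos_iff_eq_zero.1 ((ENNReal.add_le_add_iff_left hvtop).1 h1)
  have hcoef := weight_mul_sq_eq_zero hlam hQdiff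
  set δ := (1 / 2 : ℝ) • (v - w) with hδ
  have hδ0 : δ ≠ 0 := smul_ne_zero (by norm_num) (sub_ne_zero.2 hne)
  have hδk : ∀ k, k ≠ 0 → inner ℝ δ (φ k) = (0 : ℝ) := fun k hk => by
    have h1 := h.pos hΩ hρ hk
    have h2 : (lam k + τ ^ 2) ^ α ≠ 0 := by positivity
    simpa [h2] using hcoef k
  have hδφ : δ = inner ℝ δ (φ 0) • φ 0 := by
    have h1 := φ.hasSum_repr δ
    have h2 := hasSum_single (f := fun k => φ.repr δ k • φ k) 0 fun k hk => by
      rw [φ.repr_apply_apply, real_inner_comm, hδk k hk, zero_smul]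
    have h3 := h1.unique h2
    rwa [φ.repr_apply_apply, real_inner_comm] at h3
  have ha0 : inner ℝ δ (φ 0) ≠ (0 : ℝ) := fun ha => by
    rw [ha, zero_smul] at hδφ
    exact hδ0 hδφ
  have hlam0 : lam 0 = 0 := by
    have h1 : (lam 0 + τ ^ 2) ^ α = 0 := by simpa [ha0] using hcoef 0
    have := hlam 0
    have h2 := (Real.rpow_eq_zero (by positivity) (by linarith)).1 h1
    have := sq_nonneg τ
    linarith
  obtain ⟨c, hc0, hc⟩ := h.exists_eq_const hΩ hρ hlam0
  -- The difference is a nonzero constant, so v and w differ almost everywhere and the label term is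
  -- strictly smaller at the midpoint.
  have hvw : ∀ᵐ x ∂(dataMeasure Ω ρ), v x ≠ w x := by
    have h1 : v - w = (2 * inner ℝ δ (φ 0)) • φ 0 := by
      rw [mul_smul, ← hδφ, hδ, smul_smul]
      norm_num
    filter_upwards [Lp.coeFn_sub v w, Lp.coeFn_smul (2 * inner ℝ δ (φ 0)) (φ 0), hc]
      with x h2 h3 h4 h5
    rw [h1, h3, Pi.smul_apply, h4, Pi.sub_apply, h5, sub_self, smul_eq_mul] at h2
    exact mul_ne_zero (mul_ne_zero two_ne_zero ha0) hc0 h2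
  have hwtop : probit lam φ α τ (Ωpos ∪ Ωneg) y γ w ≠ ⊤ := hwv ▸ hvtop
  have hlt := labelTerm_midpoint_lt (Ω' := Ωpos ∪ Ωneg) hγ hym
    (hy.measurable_pos.union hy.measurable_neg)
    (fun h0 => hρ.measure_ne_zero hy.measurable_pos hy.subset_pos hy.volume_pos
      (measure_mono_null Set.subset_union_left h0))
    (fun x hx => by
      rcases hx with hx | hx
      · rw [hy.label_pos x hx]
        norm_num
      · rw [hy.label_neg x hx]
        norm_num)
    hvw (ne_top_of_le_ne_top hvtop le_add_self) (ne_top_of_le_ne_top hwtop le_add_self)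
  have hQfin : 2⁻¹ * (quadraticForm lam φ α τ v + quadraticForm lam φ α τ w) ≠ ⊤ :=
    ne_top_of_le_ne_top hvtop (havg ▸ le_self_add)
  refine absurd hmid (not_le.2 ?_)
  rw [← havg]
  exact ENNReal.add_lt_add_of_le_of_lt (ne_top_of_le_ne_top hQfin hQmid) hQmid hlt

end Minimizer

/-! ### Reduction to measurable labels and conclusion. -/

/-- A globally measurable representative of the labels. -/
theorem IsLabelling.exists_measurable {d : ℕ} {Ω Ωpos Ωneg : Set (Euc d)} {y : Euc d → ℝ}
    (hy : IsLabelling Ω Ωpos Ωneg y) : ∃ y' : Euc d → ℝ, Measurable y' ∧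
      (∀ x ∈ Ωpos ∪ Ωneg, y x = y' x) ∧ IsLabelling Ω Ωpos Ωneg y' := by
  classical
  have hdisj : ∀ x ∈ Ωneg, x ∉ Ωpos := fun x hx hx' =>
    Set.disjoint_left.1 hy.disjoint (subset_closure hx') (subset_closure hx)
  have h1 : ∀ x ∈ Ωpos, Ωpos.piecewise (fun _ => (1 : ℝ)) (fun _ => -1) x = 1 := fun x hx =>
    Set.piecewise_eq_of_mem _ _ _ hx
  have h2 : ∀ x ∈ Ωneg, Ωpos.piecewise (fun _ => (1 : ℝ)) (fun _ => -1) x = -1 := fun x hx =>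
    Set.piecewise_eq_of_notMem _ _ _ (hdisj x hx)
  refine ⟨Ωpos.piecewise (fun _ => 1) fun _ => -1,
    Measurable.piecewise hy.measurable_pos measurable_const measurable_const, ?_,
    { hy with label_pos := h1, label_neg := h2 }⟩
  rintro x (hx | hx)
  · rw [h1 x hx, hy.label_pos x hx]
  · rw [h2 x hx, hy.label_neg x hx]

/-- A one-point space has no two disjoint nonempty subsets. -/
theorem IsLabelling.dim_ne_zero {d : ℕ} {Ω Ωpos Ωneg : Set (Euc d)} {y : Euc d → ℝ}
    (hy : IsLabelling Ω Ωpos Ωneg y) : d ≠ 0 := by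
  rintro rfl
  obtain ⟨x, hx⟩ := nonempty_of_measure_ne_zero hy.volume_pos.ne'
  obtain ⟨x', hx'⟩ := nonempty_of_measure_ne_zero hy.volume_neg.ne'
  rw [Subsingleton.elim x' x] at hx'
  exact Set.disjoint_left.1 hy.disjoint (subset_closure hx) (subset_closure hx')

end ProbitLimit

theorem lemma4p1 {d : ℕ} {Ω Ωpos Ωneg : Set (ProbitLimit.Euc d)}
    {ρ y : ProbitLimit.Euc d → ℝ} {α τ γ : ℝ}
    (hΩ : ProbitLimit.IsC11Domain Ω) (hρ : ProbitLimit.IsSmoothDensity Ω ρ)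
    (hy : ProbitLimit.IsLabelling Ω Ωpos Ωneg y)
    (hα : 1 ≤ α) (hτ : 0 ≤ τ) (hγ : 0 < γ) :
    (∃ (lam : ℕ → ℝ) (φ : HilbertBasis ℕ ℝ (ProbitLimit.L2 Ω ρ)),
      ProbitLimit.IsEigensystem Ω ρ lam φ) ∧
    ∀ (lam : ℕ → ℝ) (φ : HilbertBasis ℕ ℝ (ProbitLimit.L2 Ω ρ)),
      ProbitLimit.IsEigensystem Ω ρ lam φ →
      ∃! v : ProbitLimit.L2 Ω ρ, v ∈ ProbitLimit.spectralSobolev lam φ α ∧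
        IsMinOn (ProbitLimit.probit lam φ α τ (Ωpos ∪ Ωneg) y γ)
          (ProbitLimit.spectralSobolev lam φ α) v := by
  have hw := hρ.isWeight hΩ
  have := hρ.isProbability
  refine ⟨ProbitLimit.exists_isEigensystem hΩ hy.dim_ne_zero hw, fun lam φ h => ?_⟩
  obtain ⟨y', hym, hyy', hy'⟩ := hy.exists_measurable
  have hlam := h.nonneg hw
  have hprobit : ProbitLimit.probit lam φ α τ (Ωpos ∪ Ωneg) y γ =
      ProbitLimit.probit lam φ α τ (Ωpos ∪ Ωneg) y' γ := by
    funext v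
    rw [ProbitLimit.probit, ProbitLimit.probit, ProbitLimit.labelTerm_congr
      (hy.measurable_pos.union hy.measurable_neg) hyy']
  rw [hprobit]
  have hmem : ∀ v, ProbitLimit.probit lam φ α τ (Ωpos ∪ Ωneg) y' γ v ≠ ⊤ →
      v ∈ ProbitLimit.spectralSobolev lam φ α := fun v hv =>
    ProbitLimit.mem_spectralSobolev_of_quadraticForm_ne_top hlam (by linarith)
      (ne_top_of_le_ne_top hv le_self_add)
  have h0 : ProbitLimit.probit lam φ α τ (Ωpos ∪ Ωneg) y' γ 0 ≠ ⊤ := by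
    rw [ProbitLimit.probit, ProbitLimit.quadraticForm_zero, zero_add]
    exact ProbitLimit.labelTerm_zero_ne_top
  -- Outside the spectral Sobolev space the functional is infinite, so a minimizer there is a global
  -- one and the uniqueness result applies.
  have hglobal : ∀ v, IsMinOn (ProbitLimit.probit lam φ α τ (Ωpos ∪ Ωneg) y' γ)
      (ProbitLimit.spectralSobolev lam φ α) v → ∀ u,
      ProbitLimit.probit lam φ α τ (Ωpos ∪ Ωneg) y' γ v ≤
        ProbitLimit.probit lam φ α τ (Ωpos ∪ Ωneg) y' γ u := fun v hv u => by
    by_cases hu : ProbitLimit.probit lam φ α τ (Ωpos ∪ Ωneg) y' γ u = ⊤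
    · rw [hu]
      exact le_top
    · exact hv (hmem u hu)
  obtain ⟨v, hv⟩ := h.exists_forall_probit_le (τ := τ) hΩ hw hy' hym hα hγ
  refine ⟨v, ⟨hmem v ((hv 0).trans_lt h0.lt_top).ne, fun u _ => hv u⟩, fun w hwmin => ?_⟩
  exact h.eq_of_forall_probit_le hΩ hw hy' hym hα hγ (hglobal w hwmin.2) hv
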